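/- **Theorem (Verlinde formula).** Let $G$ be a finite group and put $\int_G f(z)\,dz=|G|^{-1}\sum_{z\in G}f(z)$, $\delta_x(y)=|G|$ if $y=x$ and $0$ otherwise, $\langle f_1,f_2\rangle=\int_G\int_G f_1(x,y)f_2(x,y)\,dx\,dy$. The quantum double $D(G)$ is the space $C(G\times G)$ of complex functions with product $(f_1\bullet f_2)(x,y)=\int_G f_1(x,z)f_2(z^{-1}xz,z^{-1}y)\,dz$, unit $1(x,y)=\delta_e(y)$ and comultiplication $(\Delta f)(x_1,y_1;x_2,y_2)=f(x_1x_2,y_1)\,\delta_{y_1}(y_2)$. Its dual is identified with $C(G\times G)$ through the pairing, and carries the product $(f_1\star f_2)(x,y)=\int_G f_1(z,y)f_2(z^{-1}x,y)\,dz$. For each conjugacy class $A$ of $G$ choose $g_A\in A$, let $N_A$ be the centraliser of $g_A$, and choose a complete set $\{\pi_\alpha\}$ of pairwise inequivalent irreducible complex representations $\pi_\alpha:N_A\to GL(V_\alpha)$, the label $1$ denoting the trivial one; $0$ denotes the class $\{e\}$. Let $\pi^A_\alpha$ be the representation of $D(G)$ on $V^A_\alpha=\{\phi:G\to V_\alpha\mid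 \phi(xn)=\pi_\alpha(n^{-1})\phi(x)\ \forall x\in G,\,n\in N_A\}$ given by $(\pi^A_\alpha(f)\phi)(x)=\int_G f(xg_Ax^{-1},z)\phi(z^{-1}x)\,dz$, and let $\chi^A_\alpha(x,y)=\operatorname{tr}\pi^A_\alpha(\delta_x\otimes\delta_y)$ be its character. Let $S$ be the linear map $(Sf)(x,y)=f(y,x^{-1})$ of $C(G\times G)$ and $S^{BA}_{\beta\alpha}=|G|^{-1}\langle S\chi^A_\alpha,\overline{\chi^B_\beta}\rangle$. Then: 1. $S\chi^A_\alpha=\sum_{B,\beta}S^{BA}_{\beta\alpha}\chi^B_\beta$ for all $(A,\alpha)$, i.e. $(S^{BA}_{\beta\alpha})$ is the matrix of $S$ in the character basis, and $S^{0B}_{1\beta}\neq0$ for all $(B,\beta)$. 2. $S^{-1}$ diagonalises the fusion rules: the functions $S^{-1}\chi^B_\beta$ form a basis of the linear span of the characters, and for all $(A,\alpha),(B,\beta)$ $$\chi^A_\alpha\star S^{-1}\chi^B_\beta=\frac{S^{AB}_{\alpha\beta}}{S^{0B}_{1\beta}}\,S^{-1}\chi^B_\beta .$$ 3. There are non-negative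 integers $N^{AB\gamma}_{\alpha\beta C}$ (the fusion coefficients) such that $\pi^A_\alpha\otimes\pi^B_\beta\simeq\bigoplus_{C,\gamma}N^{AB\gamma}_{\alpha\beta C}\,\pi^C_\gamma$ for all $(A,\alpha),(B,\beta)$, where $D(G)$ acts on the tensor product through $\Delta$; and any such integers satisfy $\chi^A_\alpha\star\chi^B_\beta=\sum_{C,\gamma}N^{AB\gamma}_{\alpha\beta C}\,\chi^C_\gamma$ and $$N^{AB\gamma}_{\alpha\beta C}=\sum_{D,\delta}\frac{S^{DA}_{\delta\alpha}\,S^{DB}_{\delta\beta}\,\overline{S^{CD}_{\gamma\delta}}}{S^{0D}_{1\delta}} .$$ -/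

import Mathlib

open scoped BigOperators TensorProduct

universe u v w

noncomputable section

namespace DrinfeldDouble

section Functions

variable {G : Type u} [Group G] [Fintype G] [DecidableEq G]

/-- The normalised invariant integral `∫_G f(z) dz = |G|⁻¹ ∑ z, f z` (scalar or vector valued). -/
def haarInt {M : Type*} [AddCommGroup M] [Module ℂ M] (f : G → M) : M :=
  (Fintype.card G : ℂ)⁻¹ • ∑ z, f z

/-- The delta function `δ_x` on `G`, normalised by `δ_x(x) = |G|`. -/
def delta (x y : G) : ℂ := if y = x then (Fintype.card G : ℂ) else 0

/-- The bilinear pairing `⟨f₁, f₂⟩ = ∫∫ f₁(x,y) f₂(x,y) dx dy` on functions on `G × G`. -/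
def pairing (f₁ f₂ : G → G → ℂ) : ℂ :=
  haarInt fun x => haarInt fun y => f₁ x y * f₂ x y

/-- The multiplication `⋆` of the dual `D(G)^⋆`, identified with the functions on `G × G`. -/
def dualMul (f₁ f₂ : G → G → ℂ) : G → G → ℂ :=
  fun x y => haarInt fun z => f₁ z y * f₂ (z⁻¹ * x) y

end Functions

/-- The Fourier transform `(S f)(x,y) = f(y, x⁻¹)` on functions on `G × G`. -/
def fourier (G : Type u) [Group G] : (G → G → ℂ) ≃ₗ[ℂ] (G → G → ℂ) where
  toFun f := fun x y => f y x⁻¹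
  invFun f := fun x y => f y⁻¹ x
  map_add' _ _ := rfl
  map_smul' _ _ := rfl
  left_inv f := by ext x y; simp
  right_inv f := by ext x y; simp

/-- The underlying space of the quantum double `D(G)`: the functions on `G × G`.
Its product is the convolution product `•` below, not the pointwise one. -/
def QD (G : Type u) : Type u := G → G → ℂ

namespace QD

instance (G : Type u) : AddCommGroup (QD G) := inferInstanceAs (AddCommGroup (G → G → ℂ))

instance (G : Type u) : Module ℂ (QD G) := inferInstanceAs (Module ℂ (G → G → ℂ))

@[ext] theorem ext {G : Type u} {f g : QD G} (h : ∀ x y, f x y = g x y) : f = g :=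
  funext fun x => funext fun y => h x y

theorem add_apply {G : Type u} (f g : QD G) (x y : G) : (f + g) x y = f x y + g x y := rfl

theorem zero_apply {G : Type u} (x y : G) : (0 : QD G) x y = 0 := rfl

theorem smul_apply {G : Type u} (c : ℂ) (f : QD G) (x y : G) : (c • f) x y = c * f x y := rfl

variable {G : Type u} [Group G] [Fintype G] [DecidableEq G]

/-- The product `(f₁ • f₂)(x,y) = ∫ f₁(x,z) f₂(z⁻¹xz, z⁻¹y) dz` of `D(G)`. -/
instance : Mul (QD G) :=
  ⟨fun f₁ f₂ x y => haarInt fun z => f₁ x z * f₂ (z⁻¹ * x * z) (z⁻¹ * y)⟩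

/-- The unit `1(x,y) = δ_e(y)` of `D(G)`. -/
instance : One (QD G) := ⟨fun _ y => delta 1 y⟩

theorem mul_apply (f₁ f₂ : QD G) (x y : G) :
    (f₁ * f₂) x y = (Fintype.card G : ℂ)⁻¹ *
      ∑ z, f₁ x z * f₂ (z⁻¹ * x * z) (z⁻¹ * y) := rfl

theorem one_apply (x y : G) :
    (1 : QD G) x y = if y = 1 then (Fintype.card G : ℂ) else 0 := rfl

theorem card_ne_zero (G : Type u) [Group G] [Fintype G] : (Fintype.card G : ℂ) ≠ 0 :=
  Nat.cast_ne_zero.mpr Fintype.card_ne_zero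

instance : Ring (QD G) where
  __ := (inferInstance : AddCommGroup (QD G))
  left_distrib f g h := by
    ext x y
    simp only [mul_apply, add_apply, mul_add, Finset.sum_add_distrib]
  right_distrib f g h := by
    ext x y
    simp only [mul_apply, add_apply, add_mul, mul_add, Finset.sum_add_distrib]
  zero_mul f := by
    ext x y
    simp [mul_apply, zero_apply]
  mul_zero f := by
    ext x y
    simp [mul_apply, zero_apply]
  mul_assoc f g h := by
    ext x y
    simp only [mul_apply, Finset.mul_sum, Finset.sum_mul]
    rw [Finset.sum_comm]
    refine Finset.sum_congr rfl fun w _ => ?_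
    refine Fintype.sum_equiv (Equiv.mulLeft w⁻¹) _ _ fun z => ?_
    simp only [Equiv.coe_mulLeft, mul_inv_rev, inv_inv]
    have e1 : z⁻¹ * w * (w⁻¹ * x * w) * (w⁻¹ * z) = z⁻¹ * x * z := by group
    have e2 : z⁻¹ * w * (w⁻¹ * y) = z⁻¹ * y := by group
    rw [e1, e2]
    ring
  one_mul f := by
    ext x y
    have := card_ne_zero G
    simp [mul_apply, one_apply, ite_mul, this]
  mul_one f := by
    ext x y
    have := card_ne_zero G
    simp only [mul_apply, one_apply, inv_mul_eq_one, mul_ite, mul_zero]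
    rw [Finset.sum_ite_eq' Finset.univ y]
    simp only [Finset.mem_univ, if_true]
    field_simp

instance : Algebra ℂ (QD G) :=
  Algebra.ofModule
    (fun c f g => by
      ext x y
      simp only [mul_apply, smul_apply, mul_assoc, Finset.mul_sum]
      exact Finset.sum_congr rfl fun z _ => by ring)
    (fun c f g => by
      ext x y
      simp only [mul_apply, smul_apply, Finset.mul_sum]
      exact Finset.sum_congr rfl fun z _ => by ring)

/-- The element `δ_x ⊗ δ_y` of `D(G)`. -/
def deltaTensor (x y : G) : QD G := fun a b => delta x a * delta y b

/-- The comultiplication `(Δ f)(x₁,y₁;x₂,y₂) = f(x₁x₂,y₁) δ_{y₁}(y₂)`, where a function `F` of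
four variables is identified with the element
`∫∫∫∫ F(x₁,y₁;x₂,y₂) (δ_{x₁} ⊗ δ_{y₁}) ⊗ (δ_{x₂} ⊗ δ_{y₂})` of `D(G) ⊗ D(G)`. -/
def comul : QD G →ₗ[ℂ] QD G ⊗[ℂ] QD G where
  toFun f := haarInt fun x₁ : G => haarInt fun y₁ : G => haarInt fun x₂ : G => haarInt fun y₂ : G =>
    (f (x₁ * x₂) y₁ * delta y₁ y₂) • (deltaTensor x₁ y₁ ⊗ₜ[ℂ] deltaTensor x₂ y₂)
  map_add' f g := by
    simp only [haarInt, add_apply, add_mul, add_smul, Finset.sum_add_distrib, smul_add]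
  map_smul' c f := by
    simp only [haarInt, smul_apply, mul_assoc, mul_smul, Finset.smul_sum, RingHom.id_apply,
      smul_comm c]

end QD

/-- A complete set of pairwise inequivalent irreducible finite-dimensional complex
representations of a finite group `N`; `one` is the label of the trivial representation. -/
structure IrrepSystem (N : Type u) [Group N] where
  /-- labels of the irreducible representations -/
  ι : Type w
  [fintypeι : Fintype ι]
  /-- carrier spaces -/
  V : ι → Type v
  [addCommGroupV : ∀ α, AddCommGroup (V α)]
  [moduleV : ∀ α, Module ℂ (V α)]
  [finiteV : ∀ α, FiniteDimensional ℂ (V α)]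
  /-- the representations -/
  π : ∀ α, Representation ℂ N (V α)
  irreducible : ∀ α, (π α).IsIrreducible
  inequivalent : ∀ α β, Nonempty ((π α).Equiv (π β)) → α = β
  complete : ∀ (W : Type v) [AddCommGroup W] [Module ℂ W] [FiniteDimensional ℂ W]
    (ρ : Representation ℂ N W), ρ.IsIrreducible → ∃ α, Nonempty (ρ.Equiv (π α))
  one : ι
  one_trivial : ∀ n x, π one n x = x

attribute [instance] IrrepSystem.fintypeι IrrepSystem.addCommGroupV IrrepSystem.moduleV
  IrrepSystem.finiteV

/-- The choices that fix the labelling of the irreducible representations of `D(G)`: an element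
`g_A` in every conjugacy class `A`, and a complete set of irreducible representations of the
centraliser `N_A` of `g_A`. -/
structure Choices (G : Type u) [Group G] where
  g : ConjClasses G → G
  mk_g : ∀ A, ConjClasses.mk (g A) = A
  irr : ∀ A, IrrepSystem.{u, v, w} (Subgroup.centralizer {g A})

namespace Choices

variable {G : Type u} [Group G] (c : Choices.{u, v, w} G)

/-- The labels `(A, α)` of the irreducible representations of `D(G)`. -/
def Label : Type (max u w) := Σ A : ConjClasses G, (c.irr A).ι

/-- The label `(0, 1)`: the class of the identity and the trivial representation. -/
def zero : c.Label := ⟨ConjClasses.mk 1, (c.irr _).one⟩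

instance [Finite G] : Fintype c.Label :=
  letI : Fintype (ConjClasses G) := Fintype.ofFinite _
  inferInstanceAs (Fintype (Σ A : ConjClasses G, (c.irr A).ι))

/-- The carrier space `V^A_α` of functions `φ : G → V_α` with `φ(xn) = π_α(n⁻¹) φ(x)` for all
`x ∈ G` and `n ∈ N_A`. -/
def carrier (a : c.Label) : Submodule ℂ (G → (c.irr a.1).V a.2) where
  carrier := {φ | ∀ (x : G) (n : Subgroup.centralizer {c.g a.1}),
    φ (x * n) = (c.irr a.1).π a.2 n⁻¹ (φ x)}
  add_mem' hφ hψ x n := by simp only [Pi.add_apply, hφ x n, hψ x n, map_add]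
  zero_mem' x n := by simp only [Pi.zero_apply, map_zero]
  smul_mem' k φ hφ x n := by simp only [Pi.smul_apply, hφ x n, map_smul]

variable [Fintype G] [DecidableEq G]

/-- The operator `(π^A_α(f) φ)(x) = ∫ f(x g_A x⁻¹, z) φ(z⁻¹ x) dz` on `V^A_α`. -/
def act (a : c.Label) (f : QD G) : Module.End ℂ (c.carrier a) where
  toFun φ := ⟨fun x => haarInt fun z => f (x * c.g a.1 * x⁻¹) z • φ.1 (z⁻¹ * x), by
    intro x n
    have hn : (n : G) * c.g a.1 * (n : G)⁻¹ = c.g a.1 := by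
      have := Subgroup.mem_centralizer_singleton_iff.mp n.2
      rw [this, mul_inv_cancel_right]
    have e : x * n * c.g a.1 * (x * n)⁻¹ = x * c.g a.1 * x⁻¹ := by
      calc x * n * c.g a.1 * (x * n)⁻¹ = x * (n * c.g a.1 * (n : G)⁻¹) * x⁻¹ := by group
        _ = _ := by rw [hn]
    simp only [haarInt, e, map_smul, map_sum, ← mul_assoc, φ.2 _ n]⟩
  map_add' φ ψ := by
    ext x
    simp [haarInt, Finset.sum_add_distrib]
  map_smul' k φ := by
    ext x
    simp only [haarInt, Submodule.coe_smul, Pi.smul_apply, RingHom.id_apply, Finset.smul_sum,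
      smul_comm k]

theorem act_apply (a : c.Label) (f : QD G) (φ : c.carrier a) (x : G) :
    (c.act a f φ).1 x = (Fintype.card G : ℂ)⁻¹ •
      ∑ z, f (x * c.g a.1 * x⁻¹) z • φ.1 (z⁻¹ * x) := rfl

/-- The representation `π^A_α` of the algebra `D(G)` on `V^A_α`. -/
def rep (a : c.Label) : QD G →ₐ[ℂ] Module.End ℂ (c.carrier a) :=
  AlgHom.ofLinearMap
    { toFun := c.act a
      map_add' := fun f g => by
        ext φ x
        simp [act_apply, QD.add_apply, add_smul, Finset.sum_add_distrib]
      map_smul' := fun k f => by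
        ext φ x
        simp only [act_apply, QD.smul_apply, mul_smul, RingHom.id_apply, LinearMap.smul_apply,
          Submodule.coe_smul, Pi.smul_apply, Finset.smul_sum, smul_comm k] }
    (by
      ext φ x
      have := QD.card_ne_zero G
      simp [act_apply, QD.one_apply, smul_smul, this])
    (fun f g => by
      ext φ x
      simp only [LinearMap.coe_mk, AddHom.coe_mk, act_apply, Module.End.mul_apply, QD.mul_apply,
        Finset.smul_sum, smul_smul, Finset.mul_sum, Finset.sum_smul]
      rw [Finset.sum_comm]
      refine Finset.sum_congr rfl fun w _ => ?_
      refine Fintype.sum_equiv (Equiv.mulLeft w⁻¹) _ _ fun z => ?_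
      have e1 : w⁻¹ * x * c.g a.1 * (w⁻¹ * x)⁻¹ = w⁻¹ * (x * c.g a.1 * x⁻¹) * w := by group
      have e2 : (w⁻¹ * z)⁻¹ * (w⁻¹ * x) = z⁻¹ * x := by group
      simp only [Equiv.coe_mulLeft]
      rw [e1, e2]
      congr 1
      ring)

/-- The character `χ^A_α(x,y) = tr π^A_α(δ_x ⊗ δ_y)`, as a function on `G × G`; thus
`tr π^A_α(f) = ⟨χ^A_α, f⟩` for all `f` in `D(G)`. -/
def char (a : c.Label) : G → G → ℂ :=
  fun x y => LinearMap.trace ℂ (c.carrier a) (c.rep a (QD.deltaTensor x y))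

/-- The matrix `S^{BA}_{βα} = |G|⁻¹ ⟨S χ^A_α, conj χ^B_β⟩`, with arguments `(B,β)` and `(A,α)`. -/
def smat (b a : c.Label) : ℂ :=
  (Fintype.card G : ℂ)⁻¹ * pairing (fourier G (c.char a)) (fun x y => star (c.char b x y))

/-- The action of `D(G)` on `V^A_α ⊗ V^B_β` through the comultiplication. -/
def tensorAct (a b : c.Label) :
    QD G →ₗ[ℂ] Module.End ℂ (c.carrier a ⊗[ℂ] c.carrier b) :=
  (Module.endTensorEndAlgHom.comp (Algebra.TensorProduct.map (c.rep a) (c.rep b)) :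
    QD G ⊗[ℂ] QD G →ₐ[ℂ] Module.End ℂ (c.carrier a ⊗[ℂ] c.carrier b)).toLinearMap ∘ₗ QD.comul

/-- `N a b d` (for `a = (A,α)`, `b = (B,β)`, `d = (C,γ)`) are fusion coefficients:
`π^A_α ⊗ π^B_β ≃ ⨁_{C,γ} N^{ABγ}_{αβC} π^C_γ` as representations of `D(G)`, the right-hand side
being realised as a finite product of `N a b d` copies of each `V^C_γ`. -/
def IsFusion (N : c.Label → c.Label → c.Label → ℕ) : Prop :=
  ∀ a b, ∃ e : (c.carrier a ⊗[ℂ] c.carrier b) ≃ₗ[ℂ] (∀ d, Fin (N a b d) → c.carrier d),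
    ∀ (f : QD G) (t : c.carrier a ⊗[ℂ] c.carrier b) (d : c.Label) (k : Fin (N a b d)),
      e (c.tensorAct a b f t) d k = c.rep d f (e t d k)

end Choices

end DrinfeldDouble

end

/-! A module over $D(G)$ is a $G$-graded representation of $G$ in which $y$ maps degree $x$ to
degree $yxy^{-1}$. It is recovered by induction from its components of degree $g_A$, as
representations of $N_A$, so complete reducibility over each $N_A$ splits every finite-dimensional
graded representation into copies of the $\pi^C_\gamma$ (`Choices.exists_decomposition`). Applied to
tensor products this gives the fusion coefficients; taking traces turns the decomposition into an
identity for $\star$ (`dualMul_char`).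

The characters are supported on commuting pairs and invariant under simultaneous conjugation. A
function with this symmetry amounts to one class function on each $N_A$, so ordinary character
theory makes the $\chi^A_\alpha$ an orthogonal basis of all such functions (`eq_sum_char`,
`linearIndependent_char`). The symmetry is preserved by $S$ and $S^{-1}$, which gives the matrix of
$S$; unitarity of representations gives the matrix of $S^{-1}$ as its conjugate.

Conjugated by $S$, the operator $\chi^A_\alpha\star\cdot$ becomes a convolution in the second
variable. On $\chi^B_\beta$, over the point $g_B$, it convolves a class function of $N_B$ with the
irreducible character of $\pi_\beta$; by Schur's lemma this is a scalar, namely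
$S^{AB}_{\alpha\beta}/S^{0B}_{1\beta}$ (`dualMul_fourier_symm_char`). Expanding $\chi^B_\beta$ in
these eigenvectors, multiplying by $\chi^A_\alpha$ and expanding back yields the formula. -/

namespace DrinfeldDouble

open Representation

/-! ### Character theory of a finite group -/

open scoped ComplexOrder in
/-- Unitarity of representations of finite groups, at the level of characters. -/
theorem character_inv {N : Type*} [Group N] [Finite N] {W : Type*} [AddCommGroup W] [Module ℂ W]
    [FiniteDimensional ℂ W] (ρ : Representation ℂ N W) (g : N) :
    ρ.character g⁻¹ = star (ρ.character g) := by
  classical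
  have := Fintype.ofFinite N
  let b := Module.finBasis ℂ W
  let M : N → Matrix (Fin (Module.finrank ℂ W)) (Fin (Module.finrank ℂ W)) ℂ := fun h =>
    LinearMap.toMatrix b b (ρ h)
  have hM (h k : N) : M (h * k) = M h * M k := by
    simp only [M, map_mul, LinearMap.toMatrix_mul]
  have hM1 : M 1 = 1 := by simp [M, LinearMap.toMatrix_one]
  have tr (h : N) : ρ.character h = (M h).trace := LinearMap.trace_eq_matrix_trace ℂ b _
  -- The averaged, hence invariant, Hermitian form: it conjugates `M g⁻¹` into the adjoint of `M g`.
  -- The term `h = 1` makes it positive definite.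
  let P := ∑ h, (M h).conjTranspose * M h
  have hP : IsUnit P := by
    refine Matrix.PosDef.isUnit ?_
    simp only [P]
    rw [← Finset.add_sum_erase _ _ (Finset.mem_univ 1), hM1]
    refine Matrix.PosDef.add_posSemidef (by simpa using Matrix.PosDef.one) ?_
    exact Matrix.posSemidef_sum _ fun h _ => Matrix.posSemidef_conjTranspose_mul_self _
  have key : (M g).conjTranspose * P * M g = P := by
    simp only [P, Finset.mul_sum, Finset.sum_mul]
    refine Fintype.sum_equiv (Equiv.mulRight g) _ _ fun h => ?_
    simp only [Equiv.coe_mulRight, hM, Matrix.conjTranspose_mul, Matrix.mul_assoc]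
  have e : (M g).conjTranspose * P = P * M g⁻¹ := by
    calc (M g).conjTranspose * P = (M g).conjTranspose * P * (M g * M g⁻¹) := by
          rw [← hM, mul_inv_cancel, hM1, mul_one]
      _ = _ := by rw [← mul_assoc, key]
  obtain ⟨Q, hQ⟩ := hP
  rw [tr, tr, ← Matrix.trace_conjTranspose, ← Matrix.trace_units_conj Q (M g⁻¹), hQ, ← e, ← hQ]
  simp

namespace IrrepSystem

variable {N : Type u} [Group N] (I : IrrepSystem.{u, v, w} N)

/-- Frees `complete` from its universe: the representation is transported to a lifted coordinate
space. -/
theorem exists_equiv {W : Type*} [AddCommGroup W] [Module ℂ W] [FiniteDimensional ℂ W]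
    (ρ : Representation ℂ N W) (h : ρ.IsIrreducible) : ∃ α, Nonempty (ρ.Equiv (I.π α)) := by
  let e : W ≃ₗ[ℂ] ULift.{v} (Fin (Module.finrank ℂ W) → ℂ) :=
    (Module.finBasis ℂ W).equivFun.trans ULift.moduleEquiv.symm
  let σ : Representation ℂ N (ULift.{v} (Fin (Module.finrank ℂ W) → ℂ)) :=
    (e.conjAlgEquiv ℂ : Module.End ℂ W →* _).comp ρ
  let φ : ρ.Equiv σ := Representation.Equiv.mk e fun g => by
    ext x
    simp [σ]
  have hσ : σ.IsIrreducible := by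
    rw [irreducible_iff_isSimpleModule_asModule] at h ⊢
    let ψ := IntertwiningMap.equivLinearMapAsModule ρ σ φ.toIntertwiningMap
    exact IsSimpleModule.congr (LinearEquiv.ofBijective ψ φ.toLinearEquiv.bijective).symm
  obtain ⟨α, ⟨τ⟩⟩ := I.complete _ σ hσ
  exact ⟨α, ⟨φ.trans τ⟩⟩

theorem exists_equiv_of_isSimpleModule (M : Type*) [AddCommGroup M] [Module ℂ M]
    [Module (MonoidAlgebra ℂ N) M] [IsScalarTower ℂ (MonoidAlgebra ℂ N) M]
    [FiniteDimensional ℂ M] (h : IsSimpleModule (MonoidAlgebra ℂ N) M) :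
    ∃ α, ∃ e : M ≃ₗ[ℂ] I.V α, ∀ g x, e (MonoidAlgebra.single g (1 : ℂ) • x) = I.π α g (e x) := by
  have hsmul (r : MonoidAlgebra ℂ N) (x : M) :
      (ofModule' (k := ℂ) (G := N) M).asAlgebraHom r x = r • x := by
    simp [ofModule', asAlgebraHom]
  let ψ : (ofModule' (k := ℂ) (G := N) M).asModule ≃ₗ[MonoidAlgebra ℂ N] M :=
    { (AddEquiv.refl M) with
      map_smul' := fun r x => hsmul r x }
  obtain ⟨α, ⟨e⟩⟩ := I.exists_equiv (ofModule' (k := ℂ) (G := N) M)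
    ((irreducible_iff_isSimpleModule_asModule _).mpr (IsSimpleModule.congr ψ))
  refine ⟨α, e.toLinearEquiv, fun g x => ?_⟩
  have hg : MonoidAlgebra.single g (1 : ℂ) • x = ofModule' (k := ℂ) (G := N) M g x := by
    simp [ofModule']
  rw [hg]
  exact e.toIntertwiningMap.isIntertwining _ _ g x

theorem exists_decomposition_module (M : Type*) [AddCommGroup M] [Module ℂ M]
    [Module (MonoidAlgebra ℂ N) M] [IsScalarTower ℂ (MonoidAlgebra ℂ N) M]
    [FiniteDimensional ℂ M] [IsSemisimpleModule (MonoidAlgebra ℂ N) M] :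
    ∃ (n : I.ι → ℕ) (e : M ≃ₗ[ℂ] ∀ α, Fin (n α) → I.V α),
      ∀ g x α k, e (MonoidAlgebra.single g (1 : ℂ) • x) α k = I.π α g (e x α k) := by
  classical
  have : Module.Finite (MonoidAlgebra ℂ N) M := Module.Finite.of_restrictScalars_finite ℂ _ _
  obtain ⟨m, S, e₀, hS⟩ :=
    IsSemisimpleModule.exists_linearEquiv_fin_dfinsupp (MonoidAlgebra ℂ N) M
  have hfin (i : Fin m) : FiniteDimensional ℂ (S i) :=
    Module.Finite.of_injective ((S i).subtype.restrictScalars ℂ) Subtype.val_injective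
  choose a ha using fun i => I.exists_equiv_of_isSimpleModule (S i) (hS i)
  let n (α : I.ι) : ℕ := Fintype.card {i // a i = α}
  -- Sorts the simple summands by isomorphism type.
  let τ : Fin m ≃ Σ α, Fin (n α) := (Equiv.sigmaFiberEquiv a).symm.trans
    (Equiv.sigmaCongrRight fun α => Fintype.equivFin _)
  have hτ (p : Σ α, Fin (n α)) : a (τ.symm p) = p.1 := by
    simp only [τ, Equiv.symm_trans_apply, Equiv.symm_symm, Equiv.sigmaFiberEquiv]
    exact ((Fintype.equivFin _).symm p.2).2
  have hε (p : Σ α, Fin (n α)) : ∃ e : S (τ.symm p) ≃ₗ[ℂ] I.V p.1,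
      ∀ g x, e (MonoidAlgebra.single g (1 : ℂ) • x) = I.π p.1 g (e x) := hτ p ▸ ha _
  choose ε hε using hε
  let e₁ : M ≃ₗ[MonoidAlgebra ℂ N] ∀ i, S i :=
    e₀.trans (DFinsupp.linearEquivFunOnFintype)
  refine ⟨n, (e₁.restrictScalars ℂ).trans ((LinearEquiv.piCongrLeft' ℂ (fun i => S i) τ).trans
    ((LinearEquiv.piCongrRight ε).trans (LinearEquiv.piCurry ℂ fun α _ => I.V α))), ?_⟩
  intro g x α k
  change ε ⟨α, k⟩ (e₁ _ (τ.symm ⟨α, k⟩)) = I.π α g (ε ⟨α, k⟩ (e₁ x (τ.symm ⟨α, k⟩)))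
  rw [map_smul, Pi.smul_apply, hε]

theorem finrank_ne_zero (α : I.ι) : (Module.finrank ℂ (I.V α) : ℂ) ≠ 0 := by
  have : Nontrivial (I.V α) := by
    by_contra h
    rw [not_nontrivial_iff_subsingleton] at h
    obtain ⟨a, b, hab⟩ := (I.irreducible α).toNontrivial
    exact hab (SetLike.ext fun x => by
      rw [Subsingleton.elim x 0]
      exact iff_of_true a.toSubmodule.zero_mem b.toSubmodule.zero_mem)
  exact Nat.cast_ne_zero.mpr Module.finrank_pos.ne'

/-- Complete reducibility. -/
theorem exists_decomposition [Finite N] {W : Type*} [AddCommGroup W] [Module ℂ W]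
    [FiniteDimensional ℂ W] (ρ : Representation ℂ N W) :
    ∃ (n : I.ι → ℕ) (e : W ≃ₗ[ℂ] ∀ α, Fin (n α) → I.V α),
      ∀ g x α k, e (ρ g x) α k = I.π α g (e x α k) := by
  have : IsSemisimpleModule (MonoidAlgebra ℂ N) ρ.asModule :=
    (isSemisimpleRepresentation_iff_isSemisimpleModule_asModule ρ).mp inferInstance
  obtain ⟨n, e, he⟩ := I.exists_decomposition_module ρ.asModule
  refine ⟨n, ρ.asModuleEquiv.symm.trans e, fun g x α k => ?_⟩
  have := he g (ρ.asModuleEquiv.symm x) α k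
  rw [single_smul, one_smul] at this
  exact this

variable [Fintype N]

/-- Schur's lemma for the operator of a class function. -/
theorem sum_smul_eq_smul (α : I.ι) (f : N → ℂ) (hf : ∀ g h, f (h * g * h⁻¹) = f g) :
    ∑ g, f g • I.π α g⁻¹ =
      ((∑ g, f g * (I.π α).character g⁻¹) / Module.finrank ℂ (I.V α)) •
        (1 : Module.End ℂ (I.V α)) := by
  have := I.irreducible α
  let T : IntertwiningMap (I.π α) (I.π α) := ⟨∑ g, f g • I.π α g⁻¹, fun h => by
    change (∑ g, f g • I.π α g⁻¹) * I.π α h = I.π α h * (∑ g, f g • I.π α g⁻¹)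
    rw [Finset.sum_mul, Finset.mul_sum]
    refine Fintype.sum_equiv (MulAut.conj h⁻¹).toEquiv _ _ fun g => ?_
    have e : f (h⁻¹ * (g * h)) = f g := by simpa [mul_assoc] using hf g h⁻¹
    simp [e, ← map_mul, mul_assoc]⟩
  obtain ⟨k, hk⟩ := (IsIrreducible.algebraMap_intertwiningMap_bijective_of_isAlgClosed
    (ρ := I.π α)).2 T
  have hT : ∑ g, f g • I.π α g⁻¹ = k • (1 : Module.End ℂ (I.V α)) :=
    (congrArg IntertwiningMap.toLinearMap hk).symm
  have htr := congrArg (LinearMap.trace ℂ (I.V α)) hT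
  simp only [map_sum, map_smul, smul_eq_mul, LinearMap.trace_one] at htr
  have hd := I.finrank_ne_zero α
  rw [hT]
  congr 1
  rw [eq_div_iff hd, ← htr]
  rfl

/-- The trace of Schur's scalar operator times `π α u`: irreducible characters are eigenvectors of
convolution by class functions, the source of the diagonalisation. -/
theorem sum_mul_character (α : I.ι) (f : N → ℂ) (hf : ∀ g h, f (h * g * h⁻¹) = f g) (u : N) :
    ∑ g, f g * (I.π α).character (g⁻¹ * u) =
      (∑ g, f g * (I.π α).character g⁻¹) / Module.finrank ℂ (I.V α) * (I.π α).character u := by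
  have h := congrArg (fun T => LinearMap.trace ℂ (I.V α) (T * I.π α u)) (I.sum_smul_eq_smul α f hf)
  simpa [Finset.sum_mul, ← map_mul, character] using h

open scoped Classical in
theorem sum_character_mul_character_inv (α β : I.ι) :
    ∑ g, (I.π α).character g * (I.π β).character g⁻¹ =
      if α = β then (Fintype.card N : ℂ) else 0 := by
  have := I.irreducible α
  have := I.irreducible β
  have hN : (Nat.card N : ℂ) ≠ 0 := Nat.cast_ne_zero.mpr Nat.card_pos.ne'
  have : Invertible (Nat.card N : ℂ) := invertibleOfNonzero hN
  have h := char_orthonormal (I.π α) (I.π β)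
  have e : Nonempty ((I.π β).Equiv (I.π α)) ↔ α = β :=
    ⟨fun h => (I.inequivalent _ _ h).symm, fun h => h ▸ ⟨Representation.Equiv.refl _⟩⟩
  rw [inv_mul_eq_iff_eq_mul₀ hN] at h
  rw [h, Fintype.card_eq_nat_card]
  simp only [e, mul_ite, mul_one, mul_zero]

/-- The irreducible characters span the class functions. -/
theorem eq_sum_character (f : N → ℂ) (hf : ∀ g h, f (h * g * h⁻¹) = f g) (n : N) :
    f n = ∑ β, (Fintype.card N : ℂ)⁻¹ * (∑ m, f m * (I.π β).character m⁻¹) *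
      (I.π β).character n := by
  classical
  have hN : (Fintype.card N : ℂ) ≠ 0 := Nat.cast_ne_zero.mpr Fintype.card_ne_zero
  -- The remainder is orthogonal to all irreducible characters, so its operator vanishes on every
  -- irreducible, hence on the regular representation `ρ`; applied to the delta function at `1`,
  -- that operator returns `f'` itself.
  let f' : N → ℂ := fun n => f n - ∑ β, (Fintype.card N : ℂ)⁻¹ *
    (∑ m, f m * (I.π β).character m⁻¹) * (I.π β).character n
  have hf' : ∀ g h, f' (h * g * h⁻¹) = f' g := fun g h => by simp only [f', hf, char_conj]
  have h0 (α : I.ι) : ∑ g, f' g * (I.π α).character g⁻¹ = 0 := by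
    simp only [f', sub_mul, Finset.sum_sub_distrib, Finset.sum_mul]
    rw [Finset.sum_comm]
    simp only [mul_assoc _ ((I.π _).character _) _, ← Finset.mul_sum,
      sum_character_mul_character_inv]
    simp [hN, mul_right_comm _ _ (Fintype.card N : ℂ)]
  let ρ : Representation ℂ N (N → ℂ) :=
    { toFun := fun g => LinearMap.funLeft ℂ ℂ (· * g)
      map_one' := by ext; simp [LinearMap.funLeft]
      map_mul' := fun g h => by ext; simp [LinearMap.funLeft, mul_assoc] }
  obtain ⟨m, e, he⟩ := I.exists_decomposition ρ
  have key (x : N → ℂ) : ∑ g, f' g • ρ g⁻¹ x = 0 := by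
    apply e.injective
    ext α k
    have := congrArg (fun T : Module.End ℂ (I.V α) => T (e x α k)) (I.sum_smul_eq_smul α f' hf')
    simpa [h0, he] using this
  have := congrFun (key (Pi.single 1 1)) n
  simp [ρ, LinearMap.funLeft, Pi.single_apply, mul_inv_eq_one] at this
  exact sub_eq_zero.mp this

end IrrepSystem
-- Modules over the quantum double as graded representations
theorem trace_pi {ι : Type*} [Fintype ι] [DecidableEq ι] {M : ι → Type*}
    [∀ i, AddCommGroup (M i)] [∀ i, Module ℂ (M i)] [∀ i, FiniteDimensional ℂ (M i)]
    (T : Module.End ℂ (∀ i, M i)) :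
    LinearMap.trace ℂ _ T =
      ∑ i, LinearMap.trace ℂ (M i) (LinearMap.proj i ∘ₗ T ∘ₗ LinearMap.single ℂ M i) := by
  have h : T = ∑ i, (T ∘ₗ LinearMap.single ℂ M i) ∘ₗ LinearMap.proj i := by
    refine LinearMap.ext fun x => ?_
    simp only [LinearMap.sum_apply, LinearMap.comp_apply, ← map_sum]
    exact congrArg T (LinearMap.sum_single_apply M x).symm
  conv_lhs => rw [h]
  rw [map_sum]
  exact Finset.sum_congr rfl fun i _ => LinearMap.trace_comp_comm' _ _

/-- The delta in $\Delta$ forces equal second arguments, so only these tensors matter. The factor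
$|G|^2$ is the one produced by two operators of delta elements. -/
theorem QD.map_comul {G : Type u} [Group G] [Fintype G] [DecidableEq G] {X : Type*}
    [AddCommMonoid X] [Module ℂ X] (Φ : QD G ⊗[ℂ] QD G →ₗ[ℂ] X) (T : G → G → G → X)
    (hT : ∀ x y z, Φ (QD.deltaTensor x y ⊗ₜ[ℂ] QD.deltaTensor z y) =
      ((Fintype.card G : ℂ) * Fintype.card G) • T x y z) (f : QD G) :
    Φ (QD.comul f) = (Fintype.card G : ℂ)⁻¹ • ∑ x, ∑ y, f x y • ∑ z, T z y (z⁻¹ * x) := by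
  have hG := QD.card_ne_zero G
  have h : Φ (QD.comul f) = (Fintype.card G : ℂ)⁻¹ • ∑ x, ∑ y, ∑ z, f (x * z) y • T x y z := by
    simp only [QD.comul, LinearMap.coe_mk, AddHom.coe_mk, haarInt, delta, map_sum, map_smul,
      mul_ite, mul_zero, ite_smul, zero_smul, Finset.sum_ite_eq', Finset.mem_univ, if_true,
      hT, smul_smul, Finset.smul_sum]
    refine Finset.sum_congr rfl fun x _ => Finset.sum_congr rfl fun y _ =>
      Finset.sum_congr rfl fun z _ => ?_
    congr 1
    field_simp
  rw [h]
  congr 1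
  calc ∑ x, ∑ y, ∑ z, f (x * z) y • T x y z = ∑ y, ∑ x, ∑ z, f (x * z) y • T x y z :=
        Finset.sum_comm
    _ = ∑ y, ∑ x, ∑ z, f z y • T x y (x⁻¹ * z) := by
        refine Finset.sum_congr rfl fun y _ => Finset.sum_congr rfl fun x _ => ?_
        exact Fintype.sum_equiv (Equiv.mulLeft x) _ _ fun z => by simp
    _ = ∑ y, ∑ z, ∑ x, f z y • T x y (x⁻¹ * z) :=
        Finset.sum_congr rfl fun y _ => Finset.sum_comm
    _ = ∑ z, ∑ y, ∑ x, f z y • T x y (x⁻¹ * z) := Finset.sum_comm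
    _ = _ := by simp only [Finset.smul_sum]

/-- A `G`-graded representation with `ρ y` mapping degree `x` to degree `y x y⁻¹`; these are the
modules over the quantum double. -/
structure GradedRep (G : Type u) [Group G] [Fintype G] [DecidableEq G] (M : Type*)
    [AddCommGroup M] [Module ℂ M] where
  /-- projections onto the homogeneous components -/
  E : G → Module.End ℂ M
  /-- the representation of the group -/
  ρ : Representation ℂ G M
  E_mul : ∀ x y, E x * E y = if x = y then E x else 0
  sum_E : ∑ x, E x = 1
  ρ_mul_E : ∀ x y, ρ y * E x = E (y * x * y⁻¹) * ρ y

namespace GradedRep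

variable {G : Type u} [Group G] [Fintype G] [DecidableEq G]
variable {M : Type*} [AddCommGroup M] [Module ℂ M] (D : GradedRep G M)

theorem E_apply_E (x y : G) (m : M) : D.E x (D.E y m) = if x = y then D.E x m else 0 := by
  have := congrArg (fun T : Module.End ℂ M => T m) (D.E_mul x y)
  split_ifs at this ⊢ with h <;> simpa using this

theorem ρ_E (x y : G) (m : M) : D.ρ y (D.E x m) = D.E (y * x * y⁻¹) (D.ρ y m) :=
  congrArg (fun T : Module.End ℂ M => T m) (D.ρ_mul_E x y)

theorem sum_E_apply (m : M) : ∑ x, D.E x m = m := by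
  simpa using congrArg (fun T : Module.End ℂ M => T m) D.sum_E

theorem ρ_inv_apply (y : G) (m : M) : D.ρ y (D.ρ y⁻¹ m) = m := by
  rw [← Module.End.mul_apply, ← map_mul, mul_inv_cancel, map_one, Module.End.one_apply]

/-- The operator of an element of the quantum double. -/
noncomputable def act (f : QD G) : Module.End ℂ M :=
  (Fintype.card G : ℂ)⁻¹ • ∑ x, ∑ y, f x y • (D.E x * D.ρ y)

theorem act_deltaTensor (x y : G) :
    D.act (QD.deltaTensor x y) = (Fintype.card G : ℂ) • (D.E x * D.ρ y) := by
  have := QD.card_ne_zero G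
  simp [act, QD.deltaTensor, delta, smul_smul, ite_smul, this]

/-- The tensor product of graded representations. -/
noncomputable def tensor {M' : Type*} [AddCommGroup M'] [Module ℂ M'] (D' : GradedRep G M') :
    GradedRep G (M ⊗[ℂ] M') where
  -- Degrees multiply, as $f(x_1x_2,y_1)$ in $\Delta$ requires.
  E x := ∑ z, TensorProduct.map (D.E z) (D'.E (z⁻¹ * x))
  ρ := D.ρ.tprod D'.ρ
  E_mul x y := by
    simp only [Finset.sum_mul_sum, ← TensorProduct.map_mul, E_mul]
    by_cases h : x = y
    · subst h
      refine (Finset.sum_congr rfl fun z _ => ?_).trans (if_pos rfl).symm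
      rw [Finset.sum_eq_single z]
      · simp
      · intro z' _ hz
        simp [hz.symm]
      · simp
    · rw [if_neg h]
      refine Finset.sum_eq_zero fun z _ => Finset.sum_eq_zero fun z' _ => ?_
      by_cases hz : z = z'
      · subst hz
        simp [h]
      · simp [hz]
  sum_E := by
    rw [Finset.sum_comm]
    have h (z : G) : ∑ x, TensorProduct.map (D.E z) (D'.E (z⁻¹ * x)) =
        TensorProduct.map (D.E z) (LinearMap.id : M' →ₗ[ℂ] M') := by
      refine (Fintype.sum_equiv (Equiv.mulLeft z⁻¹) _
        (fun x => TensorProduct.map (D.E z) (D'.E x)) fun x => rfl).trans ?_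
      change ∑ x, TensorProduct.mapBilinear (.id ℂ) M M' M M' (D.E z) (D'.E x) = _
      rw [← map_sum, D'.sum_E]
      rfl
    simp only [h]
    change ∑ x, (TensorProduct.mapBilinear (.id ℂ) M M' M M').flip LinearMap.id (D.E x) = _
    rw [← map_sum, D.sum_E]
    exact TensorProduct.map_id
  ρ_mul_E x y := by
    change TensorProduct.map (D.ρ y) (D'.ρ y) * _ = _ * TensorProduct.map (D.ρ y) (D'.ρ y)
    simp only [Finset.sum_mul, Finset.mul_sum, ← TensorProduct.map_mul, ρ_mul_E]
    refine Fintype.sum_equiv (MulAut.conj y).toEquiv _ _ fun z => ?_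
    simp [mul_assoc]

end GradedRep

namespace Choices

variable {G : Type u} [Group G] [Fintype G] [DecidableEq G] (c : Choices.{u, v, w} G)

omit [Fintype G] [DecidableEq G] in
theorem conj_g {A : ConjClasses G} (n : Subgroup.centralizer {c.g A}) :
    (n : G) * c.g A * (n : G)⁻¹ = c.g A := by
  have := Subgroup.mem_centralizer_singleton_iff.mp n.2
  rw [this, mul_inv_cancel_right]

omit [Fintype G] [DecidableEq G] in
theorem conj_mul_g {A : ConjClasses G} (x : G) (n : Subgroup.centralizer {c.g A}) :
    x * n * c.g A * (x * n)⁻¹ = x * c.g A * x⁻¹ := by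
  calc x * n * c.g A * (x * n)⁻¹ = x * (n * c.g A * (n : G)⁻¹) * x⁻¹ := by group
    _ = _ := by rw [conj_g]

/-- The graded representation underlying `π^A_α`. -/
noncomputable def graded (a : c.Label) : GradedRep G (c.carrier a) where
  -- Degree `x` means support on the `w` with $wg_Aw^{-1}=x$, a left coset of $N_A$ or the empty
  -- set.
  E x :=
    { toFun := fun φ => ⟨fun w => if w * c.g a.1 * w⁻¹ = x then φ.1 w else 0, fun w n => by
        beta_reduce
        rw [conj_mul_g, φ.2 w n]
        split_ifs <;> simp⟩
      map_add' := fun φ ψ => by ext w; simp; split_ifs <;> simp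
      map_smul' := fun k φ => by ext w; simp }
  ρ :=
    { toFun := fun y =>
        { toFun := fun φ => ⟨fun w => φ.1 (y⁻¹ * w), fun w n => by
            beta_reduce
            rw [← mul_assoc]
            exact φ.2 _ n⟩
          map_add' := fun φ ψ => rfl
          map_smul' := fun k φ => rfl }
      map_one' := by ext; simp
      map_mul' := fun y z => by ext; simp [mul_assoc] }
  E_mul x y := by
    ext φ w
    change (if w * c.g a.1 * w⁻¹ = x then (if w * c.g a.1 * w⁻¹ = y then φ.1 w else 0) else 0) = _
    by_cases h : x = y
    · subst h
      rw [if_pos rfl]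
      change _ = if w * c.g a.1 * w⁻¹ = x then φ.1 w else 0
      split_ifs <;> rfl
    · rw [if_neg h, ite_eq_right_iff.mpr]
      · rfl
      · rintro rfl
        exact if_neg h
  sum_E := by
    ext φ w
    simp
  ρ_mul_E x y := by
    ext φ w
    change (if y⁻¹ * w * c.g a.1 * (y⁻¹ * w)⁻¹ = x then φ.1 (y⁻¹ * w) else 0) =
      if w * c.g a.1 * w⁻¹ = y * x * y⁻¹ then φ.1 (y⁻¹ * w) else 0
    refine if_congr ?_ rfl rfl
    have e : y⁻¹ * w * c.g a.1 * (y⁻¹ * w)⁻¹ = y⁻¹ * (w * c.g a.1 * w⁻¹) * y := by group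
    rw [e]
    constructor
    · rintro rfl
      group
    · intro h
      rw [h]
      group

theorem graded_E_apply (a : c.Label) (x : G) (φ : c.carrier a) (w : G) :
    ((c.graded a).E x φ).1 w = if w * c.g a.1 * w⁻¹ = x then φ.1 w else 0 := rfl

theorem graded_ρ_apply (a : c.Label) (y : G) (φ : c.carrier a) (w : G) :
    ((c.graded a).ρ y φ).1 w = φ.1 (y⁻¹ * w) := rfl

theorem rep_eq_act (a : c.Label) (f : QD G) : c.rep a f = (c.graded a).act f := by
  ext φ x
  change (Fintype.card G : ℂ)⁻¹ • ∑ z, f (x * c.g a.1 * x⁻¹) z • φ.1 (z⁻¹ * x) = _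
  simp [GradedRep.act, graded_E_apply, graded_ρ_apply]

theorem tensorAct_eq_act (a b : c.Label) (f : QD G) :
    c.tensorAct a b f = ((c.graded a).tensor (c.graded b)).act f := by
  let T (x y z : G) : Module.End ℂ (c.carrier a ⊗[ℂ] c.carrier b) :=
    TensorProduct.map ((c.graded a).E x) ((c.graded b).E z) *
      TensorProduct.map ((c.graded a).ρ y) ((c.graded b).ρ y)
  have hmap (x y z : G) : (Module.endTensorEndAlgHom.comp (Algebra.TensorProduct.map
      (c.rep a) (c.rep b)) : QD G ⊗[ℂ] QD G →ₐ[ℂ] Module.End ℂ (c.carrier a ⊗[ℂ] c.carrier b)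
      ).toLinearMap (QD.deltaTensor x y ⊗ₜ[ℂ] QD.deltaTensor z y) =
      ((Fintype.card G : ℂ) * Fintype.card G) • T x y z := by
    have h : TensorProduct.map (c.rep a (QD.deltaTensor x y)) (c.rep b (QD.deltaTensor z y)) =
        ((Fintype.card G : ℂ) * Fintype.card G) • T x y z := by
      rw [rep_eq_act, rep_eq_act, GradedRep.act_deltaTensor, GradedRep.act_deltaTensor,
        TensorProduct.map_smul_left, TensorProduct.map_smul_right, smul_smul,
        TensorProduct.map_mul]
    exact h
  refine (QD.map_comul _ T hmap f).trans ?_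
  simp only [GradedRep.act, GradedRep.tensor, Finset.sum_mul]
  rfl

end Choices
-- Characters of tensor products and existence of fusion coefficients
namespace Choices

variable {G : Type u} [Group G] [Fintype G] [DecidableEq G] (c : Choices.{u, v, w} G)

theorem char_eq_trace (a : c.Label) (x y : G) :
    c.char a x y = (Fintype.card G : ℂ) *
      LinearMap.trace ℂ (c.carrier a) ((c.graded a).E x * (c.graded a).ρ y) := by
  rw [char, rep_eq_act, GradedRep.act_deltaTensor, map_smul, smul_eq_mul]

/-- Traces multiply over tensor products, and the sum over the splittings $x=z\cdot z^{-1}x$ of the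
degree is the convolution in `dualMul`. -/
theorem trace_tensorAct (a b : c.Label) (x y : G) :
    LinearMap.trace ℂ _ (c.tensorAct a b (QD.deltaTensor x y)) =
      dualMul (c.char a) (c.char b) x y := by
  have hG := QD.card_ne_zero G
  have h : ((c.graded a).tensor (c.graded b)).E x * ((c.graded a).tensor (c.graded b)).ρ y =
      ∑ z, TensorProduct.map ((c.graded a).E z * (c.graded a).ρ y)
        ((c.graded b).E (z⁻¹ * x) * (c.graded b).ρ y) := by
    simp only [TensorProduct.map_mul, ← Finset.sum_mul]
    rfl
  rw [tensorAct_eq_act, GradedRep.act_deltaTensor, h, map_smul, map_sum]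
  simp only [LinearMap.trace_tensorProduct', dualMul, haarInt, char_eq_trace, smul_eq_mul,
    Finset.mul_sum]
  refine Finset.sum_congr rfl fun z _ => ?_
  field_simp

theorem dualMul_char {N : c.Label → c.Label → c.Label → ℕ} (hN : c.IsFusion N) (a b : c.Label) :
    dualMul (c.char a) (c.char b) = ∑ d, (N a b d : ℂ) • c.char d := by
  classical
  obtain ⟨e, he⟩ := hN a b
  ext x y
  rw [← trace_tensorAct]
  refine (LinearMap.trace_conj' (R := ℂ) (M := c.carrier a ⊗[ℂ] c.carrier b)
    (N := ∀ d, Fin (N a b d) → c.carrier d) (c.tensorAct a b (QD.deltaTensor x y)) e).symm.trans ?_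
  simp only [trace_pi, Finset.sum_apply, Pi.smul_apply, smul_eq_mul]
  refine Finset.sum_congr rfl fun d _ => ?_
  have h (k : Fin (N a b d)) : LinearMap.proj k ∘ₗ (LinearMap.proj d ∘ₗ
      (e.conj (c.tensorAct a b (QD.deltaTensor x y))) ∘ₗ LinearMap.single ℂ _ d) ∘ₗ
      LinearMap.single ℂ (fun _ => c.carrier d) k = c.rep d (QD.deltaTensor x y) := by
    refine LinearMap.ext fun φ => ?_
    simp [LinearEquiv.conj_apply, he]
  simp only [h]
  simp [char]

section Decomposition

variable {M : Type*} [AddCommGroup M] [Module ℂ M] (D : GradedRep G M)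

/-- The action of the centraliser of `g_A` on the component of degree `g_A`. -/
def homogeneousRep (A : ConjClasses G) :
    Representation ℂ (Subgroup.centralizer {c.g A}) (LinearMap.range (D.E (c.g A))) where
  toFun n := (D.ρ n).restrict (by
    rintro _ ⟨m, rfl⟩
    rw [D.ρ_E, conj_g]
    exact ⟨_, rfl⟩)
  map_one' := by ext; simp
  map_mul' m n := by ext; simp

omit [Fintype G] [DecidableEq G] in
theorem exists_mul_g_mul_inv (x : G) : ∃ A w, w * c.g A * w⁻¹ = x := by
  obtain ⟨w, hw⟩ := isConj_iff.mp (ConjClasses.mk_eq_mk_iff_isConj.mp (c.mk_g (ConjClasses.mk x)))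
  exact ⟨_, w, hw⟩

omit [Fintype G] [DecidableEq G] in
theorem eq_of_mul_g_mul_inv {A B : ConjClasses G} {w : G} (h : w * c.g A * w⁻¹ = c.g B) :
    A = B := by
  rw [← c.mk_g A, ← c.mk_g B, ConjClasses.mk_eq_mk_iff_isConj]
  exact isConj_iff.mpr ⟨w, h⟩

/-- Frobenius reciprocity: `m` goes to the functions $w\mapsto$ coordinates of
$E_{g_A}\rho(w^{-1})m$, where the degree $g_A$ component is split over $N_A$. Since
$E_x=\rho(w)E_{g_A}\rho(w)^{-1}$ for $x=wg_Aw^{-1}$, these determine every component of `m`. -/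
theorem exists_decomposition [FiniteDimensional ℂ M] :
    ∃ (n : c.Label → ℕ) (e : M ≃ₗ[ℂ] ∀ d, Fin (n d) → c.carrier d),
      (∀ x m d k, e (D.E x m) d k = (c.graded d).E x (e m d k)) ∧
      ∀ y m d k, e (D.ρ y m) d k = (c.graded d).ρ y (e m d k) := by
  classical
  have := Fintype.ofFinite (ConjClasses G)
  choose n e he using fun A => (c.irr A).exists_decomposition (c.homogeneousRep D A)
  let R (A : ConjClasses G) : M →ₗ[ℂ] LinearMap.range (D.E (c.g A)) := (D.E (c.g A)).rangeRestrict
  have hR (A : ConjClasses G) (k : Subgroup.centralizer {c.g A}) (m : M) :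
      R A (D.ρ k m) = c.homogeneousRep D A k (R A m) := by
    ext
    change D.E (c.g A) (D.ρ k m) = D.ρ k (D.E (c.g A) m)
    rw [D.ρ_E, conj_g]
  have hmem (d : c.Label) (k : Fin (n d.1 d.2)) (m : M) :
      (fun w => e d.1 (R d.1 (D.ρ w⁻¹ m)) d.2 k) ∈ c.carrier d := by
    intro w g
    beta_reduce
    rw [← he, ← hR, mul_inv_rev, map_mul]
    rfl
  let Φ : M →ₗ[ℂ] ∀ d : c.Label, Fin (n d.1 d.2) → c.carrier d :=
    { toFun := fun m d k => ⟨_, hmem d k m⟩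
      map_add' := fun m m' => by ext d k w; simp
      map_smul' := fun r m => by ext d k w; simp }
  have hΦ (m : M) (d : c.Label) (k : Fin (n d.1 d.2)) (w : G) :
      (Φ m d k).1 w = e d.1 (R d.1 (D.ρ w⁻¹ m)) d.2 k := rfl
  have hinj : Function.Injective Φ := by
    rw [← LinearMap.ker_eq_bot, LinearMap.ker_eq_bot']
    intro m hm
    rw [← D.sum_E_apply m]
    refine Finset.sum_eq_zero fun x _ => ?_
    obtain ⟨A, w, rfl⟩ := c.exists_mul_g_mul_inv x
    have h : e A (R A (D.ρ w⁻¹ m)) = 0 := by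
      ext α k
      rw [← hΦ m ⟨A, α⟩ k w, hm]
      rfl
    have h' : D.E (c.g A) (D.ρ w⁻¹ m) = 0 :=
      congrArg Subtype.val ((LinearEquiv.map_eq_zero_iff _).mp h)
    rw [← D.ρ_inv_apply w m, ← D.ρ_E, h', map_zero]
  have hsurj : Function.Surjective Φ := by
    intro ψ
    let Ψ (A : ConjClasses G) (w : G) : LinearMap.range (D.E (c.g A)) :=
      (e A).symm fun α k => (ψ ⟨A, α⟩ k).1 w
    have hΨ (A : ConjClasses G) (w : G) (g : Subgroup.centralizer {c.g A}) :
        D.ρ g (Ψ A (w * g)).1 = (Ψ A w).1 := by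
      have h : c.homogeneousRep D A g (Ψ A (w * g)) = Ψ A w := by
        apply (e A).injective
        ext α k
        rw [he]
        simp only [Ψ, LinearEquiv.apply_symm_apply]
        rw [(ψ ⟨A, α⟩ k).2 w g, ← Module.End.mul_apply, ← map_mul, mul_inv_cancel, map_one,
          Module.End.one_apply]
      exact congrArg Subtype.val h
    have hE (A : ConjClasses G) (w : G) : D.E (c.g A) (Ψ A w).1 = (Ψ A w).1 := by
      obtain ⟨m, hm⟩ := (Ψ A w).2
      rw [← hm, D.E_apply_E, if_pos rfl]
    -- By equivariance (`hΨ`) the summand is constant on cosets of $N_A$, so each coset is counted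
    -- $|N_A|$ times.
    refine ⟨∑ A, (Nat.card (Subgroup.centralizer {c.g A}) : ℂ)⁻¹ • ∑ w, D.ρ w (Ψ A w).1, ?_⟩
    have key (B : ConjClasses G) (v : G) : R B (D.ρ v⁻¹ (∑ A,
        (Nat.card (Subgroup.centralizer {c.g A}) : ℂ)⁻¹ • ∑ w, D.ρ w (Ψ A w).1)) = Ψ B v := by
      ext
      change D.E (c.g B) _ = _
      have hterm (A : ConjClasses G) (w : G) :
          D.E (c.g B) (D.ρ v⁻¹ (D.ρ w (Ψ A w).1)) =
            if c.g B = v⁻¹ * w * c.g A * (v⁻¹ * w)⁻¹ then D.ρ (v⁻¹ * w) (Ψ A w).1 else 0 := by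
        rw [← Module.End.mul_apply (D.ρ v⁻¹), ← map_mul, ← hE A w, D.ρ_E, D.E_apply_E]
        refine if_ctx_congr Iff.rfl (fun h => ?_) fun _ => rfl
        rw [h, ← D.ρ_E]
      simp only [map_sum, map_smul, hterm]
      -- Comparing degrees leaves only the class `B` and the `w` in the coset $vN_B$.
      rw [Finset.sum_eq_single B]
      · have h1 (u : G) : (if c.g B = v⁻¹ * (v * u) * c.g B * (v⁻¹ * (v * u))⁻¹ then
            D.ρ (v⁻¹ * (v * u)) (Ψ B (v * u)).1 else 0) =
            if u ∈ Subgroup.centralizer {c.g B} then (Ψ B v).1 else 0 := by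
          rw [inv_mul_cancel_left]
          refine if_ctx_congr ?_ (fun h => hΨ B v ⟨u, h⟩) fun _ => rfl
          rw [Subgroup.mem_centralizer_singleton_iff, eq_mul_inv_iff_mul_eq, eq_comm]
        rw [← Fintype.sum_equiv (Equiv.mulLeft v) _ _ fun u => (h1 u).symm, ← Finset.sum_filter,
          Finset.sum_const, ← Fintype.card_subtype, ← Nat.card_eq_fintype_card,
          ← Nat.cast_smul_eq_nsmul ℂ, smul_smul]
        have : (Nat.card {x // x ∈ Subgroup.centralizer {c.g B}} : ℂ) ≠ 0 :=
          Nat.cast_ne_zero.mpr Nat.card_pos.ne'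
        rw [inv_mul_cancel₀ this, one_smul]
      · intro A _ hA
        refine smul_eq_zero_of_right _ (Finset.sum_eq_zero fun w _ => if_neg fun h => ?_)
        exact hA (c.eq_of_mul_g_mul_inv h.symm)
      · simp
    ext d k v
    rw [hΦ, key]
    simp only [Ψ, LinearEquiv.apply_symm_apply]
    rfl
  refine ⟨fun d => n d.1 d.2, LinearEquiv.ofBijective Φ ⟨hinj, hsurj⟩, fun x m d k => ?_,
    fun y m d k => ?_⟩
  · ext w
    have h : R d.1 (D.ρ w⁻¹ (D.E x m)) =
        if w * c.g d.1 * w⁻¹ = x then R d.1 (D.ρ w⁻¹ m) else 0 := by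
      ext
      change D.E (c.g d.1) (D.ρ w⁻¹ (D.E x m)) = _
      rw [D.ρ_E, D.E_apply_E]
      have hiff : c.g d.1 = w⁻¹ * x * w⁻¹⁻¹ ↔ w * c.g d.1 * w⁻¹ = x := by
        constructor
        · intro h
          rw [h]
          group
        · rintro rfl
          group
      by_cases hx : w * c.g d.1 * w⁻¹ = x
      · rw [if_pos hx, if_pos (hiff.mpr hx)]
        rfl
      · rw [if_neg hx, if_neg (mt hiff.mp hx)]
        rfl
    change e d.1 (R d.1 (D.ρ w⁻¹ (D.E x m))) d.2 k =
      if w * c.g d.1 * w⁻¹ = x then e d.1 (R d.1 (D.ρ w⁻¹ m)) d.2 k else 0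
    rw [h]
    split_ifs <;> simp
  · ext w
    change e d.1 (R d.1 (D.ρ w⁻¹ (D.ρ y m))) d.2 k = e d.1 (R d.1 (D.ρ (y⁻¹ * w)⁻¹ m)) d.2 k
    rw [mul_inv_rev, inv_inv, map_mul, Module.End.mul_apply]

theorem exists_isFusion : ∃ N, c.IsFusion N := by
  choose n e hE hρ using fun p : c.Label × c.Label =>
    c.exists_decomposition ((c.graded p.1).tensor (c.graded p.2))
  refine ⟨fun a b => n (a, b), fun a b => ⟨e (a, b), fun f t d k => ?_⟩⟩
  rw [tensorAct_eq_act, rep_eq_act]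
  simp [GradedRep.act, hE, hρ]

end Decomposition
end Choices
-- Symmetry of the characters and their explicit form
/-- Functions on `G × G` supported on commuting pairs and invariant under simultaneous
conjugation. -/
structure IsInvariant {G : Type u} [Group G] (F : G → G → ℂ) : Prop where
  eq_zero : ∀ x y, x * y ≠ y * x → F x y = 0
  conj : ∀ w x y, F (w * x * w⁻¹) (w * y * w⁻¹) = F x y

theorem IsInvariant.fourier {G : Type u} [Group G] {F : G → G → ℂ} (hF : IsInvariant F) :
    IsInvariant (fourier G F) where
  eq_zero x y h := hF.eq_zero _ _ fun h' => h (by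
    rw [← mul_left_inj x⁻¹, ← mul_right_inj x⁻¹]
    simpa [mul_assoc] using h')
  conj w x y := by
    change F (w * y * w⁻¹) (w * x * w⁻¹)⁻¹ = F y x⁻¹
    rw [← hF.conj w y x⁻¹]
    congr 1
    group

theorem IsInvariant.fourier_symm {G : Type u} [Group G] {F : G → G → ℂ} (hF : IsInvariant F) :
    IsInvariant ((DrinfeldDouble.fourier G).symm F) where
  eq_zero x y h := hF.eq_zero _ _ fun h' => h (by
    rw [← mul_left_inj y⁻¹, ← mul_right_inj y⁻¹]
    simpa [mul_assoc] using h')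
  conj w x y := by
    change F (w * y * w⁻¹)⁻¹ (w * x * w⁻¹) = F y⁻¹ x
    rw [← hF.conj w y⁻¹ x]
    congr 1
    group

/-- `one_trivial` does not fix the dimension; orthogonality gives that its square is 1. -/
theorem IrrepSystem.finrank_one {N : Type u} [Group N] [Finite N] (I : IrrepSystem.{u, v, w} N) :
    Module.finrank ℂ (I.V I.one) = 1 := by
  have := Fintype.ofFinite N
  have h := I.sum_character_mul_character_inv I.one I.one
  have hN : (Fintype.card N : ℂ) ≠ 0 := Nat.cast_ne_zero.mpr Fintype.card_ne_zero
  have h1 (n : N) : I.π I.one n = 1 := LinearMap.ext fun x => I.one_trivial n x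
  simp only [Representation.character, h1, LinearMap.trace_one, if_true, Finset.sum_const,
    Finset.card_univ, nsmul_eq_mul, mul_eq_left₀ hN] at h
  norm_cast at h
  exact (mul_eq_one.mp h).1

namespace Choices

variable {G : Type u} [Group G] [Fintype G] [DecidableEq G] (c : Choices.{u, v, w} G)
  [∀ A, Fintype (Subgroup.centralizer {c.g A})]

omit [Fintype G] [DecidableEq G] in
theorem card_centralizer_ne_zero (A : ConjClasses G) :
    (Fintype.card (Subgroup.centralizer {c.g A}) : ℂ) ≠ 0 :=
  Nat.cast_ne_zero.mpr Fintype.card_ne_zero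

/-- The character of the representation `π_α` of `N_A`. -/
noncomputable abbrev χ (a : c.Label) : Subgroup.centralizer {c.g a.1} → ℂ :=
  ((c.irr a.1).π a.2).character

/-- Averaging over `N_A`. -/
noncomputable def average (a : c.Label) : (G → (c.irr a.1).V a.2) →ₗ[ℂ] c.carrier a where
  toFun φ := ⟨fun x => (Fintype.card (Subgroup.centralizer {c.g a.1}) : ℂ)⁻¹ •
    ∑ n : Subgroup.centralizer {c.g a.1}, (c.irr a.1).π a.2 n (φ (x * n)), fun x m => by
      simp only [map_smul, map_sum]
      congr 1
      refine Fintype.sum_equiv (Equiv.mulLeft m) _ _ fun n => ?_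
      rw [← Module.End.mul_apply, ← map_mul]
      simp [mul_assoc]⟩
  map_add' φ ψ := by ext; simp [Finset.sum_add_distrib]
  map_smul' k φ := by ext; simp [Finset.smul_sum, smul_comm k]

omit [Fintype G] [DecidableEq G] in
theorem average_comp_subtype (a : c.Label) :
    c.average a ∘ₗ (c.carrier a).subtype = LinearMap.id := by
  ext φ x
  have h (n : Subgroup.centralizer {c.g a.1}) :
      (c.irr a.1).π a.2 n (φ.1 (x * n)) = φ.1 x := by
    rw [φ.2 x n, ← Module.End.mul_apply, ← map_mul, mul_inv_cancel, map_one,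
      Module.End.one_apply]
  change (Fintype.card (Subgroup.centralizer {c.g a.1}) : ℂ)⁻¹ •
    ∑ n : Subgroup.centralizer {c.g a.1}, (c.irr a.1).π a.2 n (φ.1 (x * n)) = φ.1 x
  simp only [h, Finset.sum_const, Finset.card_univ, ← Nat.cast_smul_eq_nsmul ℂ, smul_smul]
  rw [inv_mul_cancel₀ (c.card_centralizer_ne_zero _), one_smul]

/-- Averaging is a projection onto the carrier, so `T` can be extended to all functions without
changing its trace, which is then a sum over the points of `G`. -/
theorem trace_carrier (a : c.Label) (T : Module.End ℂ (c.carrier a)) :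
    LinearMap.trace ℂ _ T = ∑ w, LinearMap.trace ℂ _ (LinearMap.proj w ∘ₗ
      ((c.carrier a).subtype ∘ₗ T ∘ₗ c.average a) ∘ₗ
        LinearMap.single ℂ (fun _ => (c.irr a.1).V a.2) w) := by
  rw [← trace_pi, LinearMap.trace_comp_comm', LinearMap.comp_assoc, average_comp_subtype,
    LinearMap.comp_id]

/-- The formula for an induced character: the diagonal block at `w` sees only those `n` with
$y^{-1}wn=w$. -/
theorem char_apply (a : c.Label) (x y : G) :
    c.char a x y = Fintype.card G * (Fintype.card (Subgroup.centralizer {c.g a.1}) : ℂ)⁻¹ *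
      ∑ w, ∑ n : Subgroup.centralizer {c.g a.1},
        if w * c.g a.1 * w⁻¹ = x ∧ w * n * w⁻¹ = y then c.χ a n else 0 := by
  rw [char_eq_trace, trace_carrier, mul_assoc]
  congr 1
  rw [Finset.mul_sum]
  refine Finset.sum_congr rfl fun w _ => ?_
  have h : LinearMap.proj w ∘ₗ ((c.carrier a).subtype ∘ₗ
      ((c.graded a).E x * (c.graded a).ρ y) ∘ₗ c.average a) ∘ₗ
        LinearMap.single ℂ (fun _ => (c.irr a.1).V a.2) w =
      (Fintype.card (Subgroup.centralizer {c.g a.1}) : ℂ)⁻¹ •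
        ∑ n : Subgroup.centralizer {c.g a.1},
          if w * c.g a.1 * w⁻¹ = x ∧ w * n * w⁻¹ = y then (c.irr a.1).π a.2 n else 0 := by
    refine LinearMap.ext fun v => ?_
    change (if w * c.g a.1 * w⁻¹ = x then
      (Fintype.card (Subgroup.centralizer {c.g a.1}) : ℂ)⁻¹ •
        ∑ n : Subgroup.centralizer {c.g a.1}, (c.irr a.1).π a.2 n
          ((Pi.single w v : G → (c.irr a.1).V a.2) (y⁻¹ * w * n)) else 0) = _
    have hiff (n : G) : y⁻¹ * w * n = w ↔ w * n * w⁻¹ = y := by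
      rw [mul_assoc, inv_mul_eq_iff_eq_mul, mul_inv_eq_iff_eq_mul]
    by_cases hx : w * c.g a.1 * w⁻¹ = x
    · simp only [hx, if_true, true_and, LinearMap.smul_apply, LinearMap.sum_apply,
        Pi.single_apply, hiff]
      congr 1
      refine Finset.sum_congr rfl fun n _ => ?_
      split_ifs <;> simp
    · simp [hx]
  rw [h, map_smul, map_sum, smul_eq_mul]
  congr 1
  refine Finset.sum_congr rfl fun n _ => ?_
  split_ifs
  · rfl
  · simp

end Choices
-- Orthogonality and completeness of the characters
theorem sum_comm_four {ι₁ ι₂ κ₁ κ₂ M : Type*} [Fintype ι₁] [Fintype ι₂] [Fintype κ₁] [Fintype κ₂]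
    [AddCommMonoid M] (f : ι₁ → ι₂ → κ₁ → κ₂ → M) :
    ∑ i, ∑ j, ∑ k, ∑ l, f i j k l = ∑ k, ∑ l, ∑ i, ∑ j, f i j k l := by
  calc ∑ i, ∑ j, ∑ k, ∑ l, f i j k l = ∑ i, ∑ k, ∑ j, ∑ l, f i j k l :=
        Finset.sum_congr rfl fun i _ => Finset.sum_comm
    _ = ∑ k, ∑ i, ∑ j, ∑ l, f i j k l := Finset.sum_comm
    _ = ∑ k, ∑ i, ∑ l, ∑ j, f i j k l :=
        Finset.sum_congr rfl fun k _ => Finset.sum_congr rfl fun i _ => Finset.sum_comm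
    _ = ∑ k, ∑ l, ∑ i, ∑ j, f i j k l := Finset.sum_congr rfl fun k _ => Finset.sum_comm

theorem pairing_eq {G : Type u} [Group G] [Fintype G] [DecidableEq G] (f₁ f₂ : G → G → ℂ) :
    pairing f₁ f₂ = (Fintype.card G : ℂ)⁻¹ * (Fintype.card G : ℂ)⁻¹ *
      ∑ x, ∑ y, f₁ x y * f₂ x y := by
  simp only [pairing, haarInt, smul_eq_mul, ← Finset.mul_sum, mul_assoc]

namespace Choices

variable {G : Type u} [Group G] [Fintype G] [DecidableEq G] (c : Choices.{u, v, w} G)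

omit [Fintype G] [DecidableEq G] in
/-- Functions with the symmetry of the characters are determined by their values on the pairs
`(g_A, n)` with `n ∈ N_A`. -/
theorem ext_of_isInvariant {F F' : G → G → ℂ} (hF : IsInvariant F) (hF' : IsInvariant F')
    (h : ∀ A (n : Subgroup.centralizer {c.g A}), F (c.g A) n = F' (c.g A) n) : F = F' := by
  ext x y
  obtain ⟨A, w, rfl⟩ := c.exists_mul_g_mul_inv x
  have hy : y = w * (w⁻¹ * y * w) * w⁻¹ := by group
  rw [hy, hF.conj, hF'.conj]
  by_cases hn : w⁻¹ * y * w ∈ Subgroup.centralizer {c.g A}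
  · exact h A ⟨_, hn⟩
  · rw [Subgroup.mem_centralizer_singleton_iff] at hn
    rw [hF.eq_zero _ _ (Ne.symm hn), hF'.eq_zero _ _ (Ne.symm hn)]

variable [∀ A, Fintype (Subgroup.centralizer {c.g A})]

theorem isInvariant_char (a : c.Label) : IsInvariant (c.char a) where
  eq_zero x y h := by
    rw [char_apply]
    refine mul_eq_zero_of_right _ (Finset.sum_eq_zero fun w _ => Finset.sum_eq_zero fun n _ =>
      if_neg ?_)
    rintro ⟨rfl, rfl⟩
    have := Subgroup.mem_centralizer_singleton_iff.mp n.2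
    apply h
    calc w * c.g a.1 * w⁻¹ * (w * n * w⁻¹) = w * (c.g a.1 * n) * w⁻¹ := by group
      _ = w * (n * c.g a.1) * w⁻¹ := by rw [this]
      _ = _ := by group
  conj v x y := by
    rw [char_apply, char_apply]
    congr 1
    refine (Fintype.sum_equiv (Equiv.mulLeft v) _ _ fun w => Finset.sum_congr rfl fun n _ =>
      if_congr ?_ rfl rfl).symm
    have e (z : G) : v * w * z * (v * w)⁻¹ = v * (w * z * w⁻¹) * v⁻¹ := by group
    simp only [Equiv.coe_mulLeft, e, mul_left_inj, mul_right_inj]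

theorem char_g (a : c.Label) (m : Subgroup.centralizer {c.g a.1}) :
    c.char a (c.g a.1) m = Fintype.card G * c.χ a m := by
  classical
  have hN := c.card_centralizer_ne_zero a.1
  have h (w : G) : (∑ n : Subgroup.centralizer {c.g a.1},
      if w * c.g a.1 * w⁻¹ = c.g a.1 ∧ w * n * w⁻¹ = m then c.χ a n else 0) =
      if w ∈ Subgroup.centralizer {c.g a.1} then c.χ a m else 0 := by
    have hiff : w * c.g a.1 * w⁻¹ = c.g a.1 ↔ w ∈ Subgroup.centralizer {c.g a.1} := by
      rw [Subgroup.mem_centralizer_singleton_iff, mul_inv_eq_iff_eq_mul]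
    by_cases hw : w ∈ Subgroup.centralizer {c.g a.1}
    -- Each `w` in $N_A$ admits exactly one `n`, a conjugate of `m`, on which the character takes
    -- the same value.
    · rw [Finset.sum_eq_single (⟨w, hw⟩⁻¹ * m * ⟨w, hw⟩)]
      · rw [if_pos hw, if_pos ⟨hiff.mpr hw, by simp [mul_assoc]⟩]
        have := ((c.irr a.1).π a.2).char_conj m (⟨w, hw⟩⁻¹)
        rwa [inv_inv] at this
      · rintro n _ hn
        refine if_neg fun h => hn ?_
        ext
        simp [← h.2, mul_assoc]
      · simp
    · rw [if_neg hw]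
      exact Finset.sum_eq_zero fun n _ => if_neg fun h => hw (hiff.mp h.1)
  simp only [char_apply, h]
  rw [← Finset.sum_filter, Finset.sum_const, ← Fintype.card_of_subtype
    (p := (· ∈ Subgroup.centralizer {c.g a.1})) _ (fun w => by simp),
    nsmul_eq_mul]
  field_simp

theorem char_g_of_ne (a : c.Label) {B : ConjClasses G} (h : B ≠ a.1) (y : G) :
    c.char a (c.g B) y = 0 := by
  rw [char_apply]
  refine mul_eq_zero_of_right _ (Finset.sum_eq_zero fun w _ => Finset.sum_eq_zero fun n _ =>
    if_neg fun h' => h (c.eq_of_mul_g_mul_inv h'.1).symm)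

/-- By invariance of `F` all `w` in `char_apply` contribute equally. This reduces pairings on
$G\times G$ to sums over $N_A$. -/
theorem sum_char_mul (a : c.Label) (F : G → G → ℂ)
    (hF : ∀ w x y, F (w * x * w⁻¹) (w * y * w⁻¹) = F x y) :
    ∑ x, ∑ y, c.char a x y * F x y = (Fintype.card G : ℂ) * Fintype.card G *
      (Fintype.card (Subgroup.centralizer {c.g a.1}) : ℂ)⁻¹ *
        ∑ n : Subgroup.centralizer {c.g a.1}, c.χ a n * F (c.g a.1) n := by
  have h (w : G) (n : Subgroup.centralizer {c.g a.1}) :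
      ∑ x, ∑ y, (if w * c.g a.1 * w⁻¹ = x ∧ w * n * w⁻¹ = y then c.χ a n else 0) * F x y =
        c.χ a n * F (c.g a.1) n := by
    simp only [ite_and, ite_mul, zero_mul]
    simp [hF]
  calc ∑ x, ∑ y, c.char a x y * F x y = (Fintype.card G : ℂ) *
      (Fintype.card (Subgroup.centralizer {c.g a.1}) : ℂ)⁻¹ *
      ∑ w : G, ∑ n : Subgroup.centralizer {c.g a.1}, ∑ x, ∑ y,
        (if w * c.g a.1 * w⁻¹ = x ∧ w * n * w⁻¹ = y then c.χ a n else 0) * F x y := by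
        simp only [char_apply, mul_assoc, ← Finset.mul_sum, Finset.sum_mul]
        congr 2
        exact sum_comm_four _
    _ = _ := by
        simp only [h, Finset.sum_const, Finset.card_univ, nsmul_eq_mul]
        ring

theorem star_char (a : c.Label) (x y : G) : star (c.char a x y) = c.char a x y⁻¹ := by
  simp only [char_apply, star_mul', star_sum, star_inv₀, star_natCast]
  congr 1
  refine Finset.sum_congr rfl fun w _ => Fintype.sum_equiv (Equiv.inv _) _ _ fun n => ?_
  rw [Equiv.inv_apply, χ, character_inv]
  have : w * (n⁻¹ : Subgroup.centralizer {c.g a.1}) * w⁻¹ = y⁻¹ ↔ w * n * w⁻¹ = y := by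
    rw [← inv_inj]
    simp [mul_assoc]
  simp only [this]
  split_ifs <;> simp

theorem pairing_star_char {F : G → G → ℂ} (hF : IsInvariant F) (a : c.Label) :
    pairing F (fun x y => star (c.char a x y)) =
      (Fintype.card (Subgroup.centralizer {c.g a.1}) : ℂ)⁻¹ *
        ∑ n : Subgroup.centralizer {c.g a.1}, F (c.g a.1) n * c.χ a n⁻¹ := by
  have hG := QD.card_ne_zero G
  have h₁ := c.sum_char_mul a (fun x y => F x y⁻¹) fun w x y => by
    rw [← hF.conj w x y⁻¹]
    congr 1
    group
  have h₂ : ∑ x, ∑ y, F x y * star (c.char a x y) = ∑ x, ∑ y, c.char a x y * F x y⁻¹ :=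
    Finset.sum_congr rfl fun x _ => Fintype.sum_equiv (Equiv.inv G) _ _ fun y => by
      rw [star_char, mul_comm, Equiv.inv_apply, inv_inv]
  have h₃ : ∑ n : Subgroup.centralizer {c.g a.1}, F (c.g a.1) n * c.χ a n⁻¹ =
      ∑ n : Subgroup.centralizer {c.g a.1}, c.χ a n * F (c.g a.1) (n : G)⁻¹ :=
    Fintype.sum_equiv (Equiv.inv _) _ _ fun n => by simp [mul_comm]
  rw [pairing_eq, h₂, h₁, h₃]
  field_simp

theorem pairing_self (a : c.Label) :
    pairing (c.char a) (fun x y => star (c.char a x y)) = Fintype.card G := by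
  have hN := c.card_centralizer_ne_zero a.1
  have h := (c.irr a.1).sum_character_mul_character_inv a.2 a.2
  rw [if_pos rfl] at h
  simp only [pairing_star_char c (c.isInvariant_char a), char_g, mul_assoc (Fintype.card G : ℂ),
    ← Finset.mul_sum, h]
  field_simp

theorem pairing_of_ne {a b : c.Label} (hab : a ≠ b) :
    pairing (c.char a) (fun x y => star (c.char b x y)) = 0 := by
  rw [c.pairing_star_char (c.isInvariant_char a)]
  obtain ⟨A, α⟩ := a
  obtain ⟨B, β⟩ := b
  refine mul_eq_zero_of_right _ ?_
  by_cases hAB : B = A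
  · subst hAB
    have h := (c.irr B).sum_character_mul_character_inv α β
    rw [if_neg (show α ≠ β by rintro rfl; exact hab rfl)] at h
    calc _ = ∑ n : Subgroup.centralizer {c.g B}, (Fintype.card G : ℂ) *
          (((c.irr B).π α).character n * ((c.irr B).π β).character n⁻¹) :=
          Finset.sum_congr rfl fun n _ => by
            rw [← mul_assoc]
            exact congrArg (· * _) (c.char_g ⟨B, α⟩ n)
      _ = 0 := by rw [← Finset.mul_sum, h, mul_zero]
  · exact Finset.sum_eq_zero fun n _ => mul_eq_zero_of_left (c.char_g_of_ne ⟨A, α⟩ hAB _) _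

omit [DecidableEq G] [∀ A, Fintype (Subgroup.centralizer {c.g A})] in
theorem sum_label_eq (B : ConjClasses G) (f : c.Label → ℂ) (hf : ∀ a : c.Label, a.1 ≠ B → f a = 0) :
    ∑ a, f a = ∑ β, f ⟨B, β⟩ := by
  let _ : Fintype (ConjClasses G) := Fintype.ofFinite _
  refine (Fintype.sum_sigma (fun a : Σ A, (c.irr A).ι => f a)).trans ?_
  refine Finset.sum_eq_single B (fun A _ hA => Finset.sum_eq_zero fun α _ => hf ⟨A, α⟩ hA) ?_
  simp

/-- The characters span the functions with their symmetry. -/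
theorem eq_sum_char {F : G → G → ℂ} (hF : IsInvariant F) :
    F = ∑ a, ((Fintype.card G : ℂ)⁻¹ * pairing F (fun x y => star (c.char a x y))) • c.char a := by
  have hG := QD.card_ne_zero G
  refine c.ext_of_isInvariant hF ⟨fun x y h => ?_, fun w x y => ?_⟩ fun B n => ?_
  · simp [fun a => (c.isInvariant_char a).eq_zero x y h]
  · simp [fun a => (c.isInvariant_char a).conj w x y]
  · simp only [Finset.sum_apply, Pi.smul_apply, smul_eq_mul]
    rw [c.sum_label_eq B _ fun a ha => mul_eq_zero_of_right _ (c.char_g_of_ne a ha.symm n)]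
    rw [(c.irr B).eq_sum_character (fun n => F (c.g B) n) (fun m h => by
      rw [← hF.conj h (c.g B) m, conj_g]
      rfl) n]
    refine Finset.sum_congr rfl fun β _ => ?_
    have h1 : c.char ⟨B, β⟩ (c.g B) n = Fintype.card G * ((c.irr B).π β).character n :=
      c.char_g ⟨B, β⟩ n
    have h2 := c.pairing_star_char hF ⟨B, β⟩
    rw [h1, h2]
    field_simp

end Choices
-- The matrix of $S$, diagonalisation and the Verlinde formula
theorem dualMul_sum_smul {G : Type u} [Group G] [Fintype G] [DecidableEq G] {ι : Type*}
    [Fintype ι] (f : G → G → ℂ) (r : ι → ℂ) (g : ι → G → G → ℂ) :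
    dualMul f (∑ i, r i • g i) = ∑ i, r i • dualMul f (g i) := by
  ext x y
  simp only [dualMul, haarInt, Finset.sum_apply, Pi.smul_apply, smul_eq_mul, Finset.mul_sum]
  rw [Finset.sum_comm]
  exact Finset.sum_congr rfl fun i _ => Finset.sum_congr rfl fun z _ => by ring

namespace Choices

variable {G : Type u} [Group G] [Fintype G] [DecidableEq G] (c : Choices.{u, v, w} G)
  [∀ A, Fintype (Subgroup.centralizer {c.g A})]

theorem fourier_char (a : c.Label) : fourier G (c.char a) = ∑ b, c.smat b a • c.char b :=
  c.eq_sum_char (c.isInvariant_char a).fourier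

theorem char_eq_sum_fourier_symm (a : c.Label) :
    c.char a = ∑ b, c.smat b a • (fourier G).symm (c.char b) := by
  apply (fourier G).injective
  simp only [map_sum, map_smul, LinearEquiv.apply_symm_apply]
  exact c.fourier_char a

theorem smat_eq (b a : c.Label) :
    c.smat b a = (Fintype.card G : ℂ)⁻¹ * ((Fintype.card G : ℂ)⁻¹ * (Fintype.card G : ℂ)⁻¹ *
      ∑ x, ∑ y, c.char a y x⁻¹ * c.char b x y⁻¹) := by
  simp only [smat, pairing_eq, star_char]
  rfl

theorem smat_symm (a b : c.Label) : c.smat a b = c.smat b a := by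
  rw [smat_eq, smat_eq, Finset.sum_comm]
  simp only [mul_comm]

/-- Complex conjugation inverts the second argument of a character, so inverting a summation
variable turns the coefficients into conjugates of entries of $S$; with `smat_symm`, this is
unitarity of $S$. -/
theorem fourier_symm_char (b : c.Label) :
    (fourier G).symm (c.char b) = ∑ d, star (c.smat b d) • c.char d := by
  refine (c.eq_sum_char (c.isInvariant_char b).fourier_symm).trans ?_
  refine Finset.sum_congr rfl fun d _ => ?_
  congr 1
  rw [smat_eq, pairing_eq]
  simp only [star_mul', star_sum, star_inv₀, star_natCast, star_char, inv_inv]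
  congr 2
  rw [Finset.sum_comm]
  refine Fintype.sum_equiv (Equiv.inv G) _ _ fun y => Finset.sum_congr rfl fun x _ => ?_
  exact mul_comm _ _

theorem smat_eq_sum (a b : c.Label) :
    c.smat a b = (Fintype.card G : ℂ)⁻¹ *
      (Fintype.card (Subgroup.centralizer {c.g b.1}) : ℂ)⁻¹ *
        ∑ n : Subgroup.centralizer {c.g b.1}, c.char a n (c.g b.1)⁻¹ * c.χ b n⁻¹ := by
  have hG := QD.card_ne_zero G
  have h := c.pairing_star_char (c.isInvariant_char a).fourier b
  rw [smat_symm, smat, h, mul_assoc]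
  rfl

theorem char_zero_apply (x : G) (A : ConjClasses G) :
    c.char c.zero x (c.g A)⁻¹ = if x = 1 then (Fintype.card G : ℂ) else 0 := by
  have hg : c.g c.zero.1 = 1 := by
    have h := ConjClasses.mk_eq_mk_iff_isConj.mp (c.mk_g c.zero.1)
    simpa using h
  split_ifs with h
  · have hm : (c.g A)⁻¹ ∈ Subgroup.centralizer {c.g c.zero.1} := by
      rw [hg]
      simp [Subgroup.mem_centralizer_singleton_iff]
    have h1 : (c.irr c.zero.1).π c.zero.2 ⟨_, hm⟩ = 1 :=
      LinearMap.ext fun x => (c.irr c.zero.1).one_trivial _ x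
    have h2 : c.χ c.zero ⟨_, hm⟩ = 1 := by
      rw [χ, Representation.character, h1, LinearMap.trace_one]
      exact congrArg Nat.cast (c.irr c.zero.1).finrank_one |>.trans Nat.cast_one
    rw [h, ← hg, c.char_g c.zero ⟨_, hm⟩, h2, mul_one]
  · rw [char_apply]
    refine mul_eq_zero_of_right _ (Finset.sum_eq_zero fun w _ => Finset.sum_eq_zero fun n _ =>
      if_neg ?_)
    rintro ⟨h', -⟩
    rw [hg] at h'
    exact h (by simpa using h'.symm)

/-- The character of label `zero` kills every term but `n = 1`, leaving the dimension of
$\pi_\beta$. -/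
theorem smat_zero (b : c.Label) :
    c.smat c.zero b = Module.finrank ℂ ((c.irr b.1).V b.2) /
      Fintype.card (Subgroup.centralizer {c.g b.1}) := by
  have hG := QD.card_ne_zero G
  have h (n : Subgroup.centralizer {c.g b.1}) :
      c.char c.zero n (c.g b.1)⁻¹ * c.χ b n⁻¹ =
        if n = 1 then (Fintype.card G : ℂ) * c.χ b 1 else 0 := by
    rw [c.char_zero_apply]
    by_cases hn : n = 1
    · simp [hn]
    · simp [hn]
  rw [smat_eq_sum]
  simp only [h, Finset.sum_ite_eq', Finset.mem_univ, if_true, Representation.char_one]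
  field_simp

theorem smat_zero_ne_zero (b : c.Label) : c.smat c.zero b ≠ 0 := by
  rw [smat_zero]
  exact div_ne_zero ((c.irr b.1).finrank_ne_zero b.2) (c.card_centralizer_ne_zero b.1)

omit [∀ A, Fintype (Subgroup.centralizer {c.g A})] in
theorem fourier_dualMul_apply (a b : c.Label) (x y : G) :
    fourier G (dualMul (c.char a) ((fourier G).symm (c.char b))) x y =
      (Fintype.card G : ℂ)⁻¹ * ∑ z, c.char a z x⁻¹ * c.char b x (z⁻¹ * y) := by
  have h (z : G) : (fourier G).symm (c.char b) (z⁻¹ * y) x⁻¹ = c.char b x (z⁻¹ * y) := by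
    change c.char b x⁻¹⁻¹ _ = _
    rw [inv_inv]
  simp only [← h]
  rfl

/-- Allows the eigenvalue equation to be checked only at the pairs $(g_B,n)$. If `x` commutes with
`z` and with $z^{-1}y$, it commutes with `y`. -/
theorem isInvariant_fourier_dualMul (a b : c.Label) :
    IsInvariant (fourier G (dualMul (c.char a) ((fourier G).symm (c.char b)))) where
  eq_zero x y h := by
    rw [fourier_dualMul_apply]
    refine mul_eq_zero_of_right _ (Finset.sum_eq_zero fun z _ => ?_)
    by_contra hz
    have h₁ : Commute z x⁻¹ := by
      by_contra h'
      exact hz (mul_eq_zero_of_left ((c.isInvariant_char a).eq_zero _ _ h') _)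
    have h₂ : Commute x (z⁻¹ * y) := by
      by_contra h'
      exact hz (mul_eq_zero_of_right _ ((c.isInvariant_char b).eq_zero _ _ h'))
    have h₃ := (Commute.inv_right_iff.mp h₁).symm.mul_right h₂
    rw [mul_inv_cancel_left] at h₃
    exact h h₃
  conj w x y := by
    rw [fourier_dualMul_apply, fourier_dualMul_apply]
    congr 1
    refine (Fintype.sum_equiv (MulAut.conj w).toEquiv _ _ fun z => ?_).symm
    rw [← (c.isInvariant_char a).conj w z, ← (c.isInvariant_char b).conj w x]
    simp [mul_assoc]

theorem dualMul_fourier_symm_char (a b : c.Label) :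
    dualMul (c.char a) ((fourier G).symm (c.char b)) =
      (c.smat a b / c.smat c.zero b) • (fourier G).symm (c.char b) := by
  have hG := QD.card_ne_zero G
  have hN := c.card_centralizer_ne_zero b.1
  apply (fourier G).injective
  rw [map_smul, LinearEquiv.apply_symm_apply]
  have hb := c.isInvariant_char b
  refine c.ext_of_isInvariant (c.isInvariant_fourier_dualMul a b)
    ⟨fun x y h => by simp [hb.eq_zero x y h], fun w x y => by simp [hb.conj w x y]⟩ fun B n => ?_
  rw [fourier_dualMul_apply, Pi.smul_apply, Pi.smul_apply, smul_eq_mul]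
  by_cases hB : B = b.1
  · subst hB
    -- Only `z` commuting with $g_B$ contribute.
    have h1 : ∑ z, c.char a z (c.g b.1)⁻¹ * c.char b (c.g b.1) (z⁻¹ * n) =
        ∑ z : Subgroup.centralizer {c.g b.1},
          c.char a z (c.g b.1)⁻¹ *
            c.char b (c.g b.1) ((z⁻¹ * n : Subgroup.centralizer {c.g b.1}) : G) := by
      refine (Fintype.sum_of_injective _ Subtype.val_injective _ _ (fun z hz => ?_)
        fun z => rfl).symm
      refine mul_eq_zero_of_left ((c.isInvariant_char a).eq_zero _ _ fun h => hz ?_) _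
      rw [Subtype.range_coe]
      exact Subgroup.mem_centralizer_singleton_iff.mpr (Commute.inv_right_iff.mp h)
    -- The function $z\mapsto\chi^A_\alpha(z,g_B^{-1})$ is a class function on $N_B$, because
    -- conjugation by $N_B$ fixes $g_B$. By `smat_eq_sum` and `smat_zero` the Schur scalar, divided
    -- by $|G|$, is the stated ratio.
    have h2 := (c.irr b.1).sum_mul_character b.2
      (fun z : Subgroup.centralizer {c.g b.1} => c.char a z (c.g b.1)⁻¹) (fun z h => by
        have e : (h : G) * (c.g b.1)⁻¹ * (h : G)⁻¹ = (c.g b.1)⁻¹ := by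
          conv_rhs => rw [← conj_g c h]
          group
        have h₁ := (c.isInvariant_char a).conj h z (c.g b.1)⁻¹
        rwa [e] at h₁) n
    rw [h1, smat_zero, smat_eq_sum]
    simp only [char_g, mul_left_comm _ (Fintype.card G : ℂ), ← Finset.mul_sum, h2]
    have hd := (c.irr b.1).finrank_ne_zero b.2
    field_simp
  · simp [c.char_g_of_ne b hB]

theorem linearIndependent_char : LinearIndependent ℂ c.char := by
  classical
  have hG := QD.card_ne_zero G
  rw [Fintype.linearIndependent_iff]
  intro r hr a
  have h : pairing (∑ b, r b • c.char b) (fun x y => star (c.char a x y)) =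
      ∑ b, r b * pairing (c.char b) (fun x y => star (c.char a x y)) := by
    simp only [pairing_eq, Finset.sum_apply, Pi.smul_apply, smul_eq_mul, Finset.sum_mul,
      Finset.mul_sum]
    refine ((Finset.sum_congr rfl fun x _ => Finset.sum_comm).trans Finset.sum_comm).trans ?_
    exact Finset.sum_congr rfl fun b _ => Finset.sum_congr rfl fun x _ =>
      Finset.sum_congr rfl fun y _ => by ring
  rw [hr, Finset.sum_eq_single a (fun b _ hb => by rw [c.pairing_of_ne hb, mul_zero]) (by simp),
    pairing_self] at h
  simpa [pairing_eq, hG] using h.symm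

theorem span_fourier_symm_char :
    Submodule.span ℂ (Set.range fun b => (fourier G).symm (c.char b)) =
      Submodule.span ℂ (Set.range c.char) := by
  apply le_antisymm <;> rw [Submodule.span_le] <;> rintro _ ⟨b, rfl⟩
  · beta_reduce
    rw [fourier_symm_char]
    exact Submodule.sum_mem _ fun d _ =>
      Submodule.smul_mem _ _ (Submodule.subset_span (Set.mem_range_self d))
  · rw [char_eq_sum_fourier_symm]
    exact Submodule.sum_mem _ fun d _ =>
      Submodule.smul_mem _ _ (Submodule.subset_span (Set.mem_range_self d))

/-- The Verlinde formula. -/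
theorem verlinde {N : c.Label → c.Label → c.Label → ℕ} (hN : c.IsFusion N) (a b d : c.Label) :
    (N a b d : ℂ) =
      ∑ e, c.smat e a * c.smat e b * star (c.smat d e) / c.smat c.zero e := by
  have h1 : ∑ d, (N a b d : ℂ) • c.char d = ∑ d, (∑ e, c.smat e a * c.smat e b *
      star (c.smat d e) / c.smat c.zero e) • c.char d := by
    -- Multiplication by $\chi_a$ is now diagonal; expanding the eigenvectors back into characters
    -- and using the symmetry of $S$ gives the coefficients.
    rw [← dualMul_char c hN, c.char_eq_sum_fourier_symm b, dualMul_sum_smul]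
    simp only [dualMul_fourier_symm_char]
    simp only [fourier_symm_char, Finset.smul_sum, Finset.sum_smul, smul_smul]
    rw [Finset.sum_comm]
    refine Finset.sum_congr rfl fun d _ => Finset.sum_congr rfl fun e _ => ?_
    rw [c.smat_symm a e, c.smat_symm d e]
    congr 1
    ring
  have h2 := Fintype.linearIndependent_iff.mp c.linearIndependent_char
    (fun d => (N a b d : ℂ) - ∑ e, c.smat e a * c.smat e b *
      star (c.smat d e) / c.smat c.zero e)
    (by simp only [sub_smul, Finset.sum_sub_distrib, h1, sub_self]) d
  exact sub_eq_zero.mp h2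

end Choices
end DrinfeldDouble

open DrinfeldDouble in
theorem mainTheorem1 {G : Type u} [Group G] [Fintype G] [DecidableEq G]
    (c : Choices.{u, v, w} G) :
    -- `S` is the matrix of the Fourier transform on the basis of characters
    (∀ a, fourier G (c.char a) = ∑ b, c.smat b a • c.char b) ∧
    -- the denominators do not vanish
    (∀ b, c.smat c.zero b ≠ 0) ∧
    -- the `S⁻¹ χ_b` are a basis of the span of the characters ...
    LinearIndependent ℂ (fun b => (fourier G).symm (c.char b)) ∧
    Submodule.span ℂ (Set.range fun b => (fourier G).symm (c.char b)) =
      Submodule.span ℂ (Set.range c.char) ∧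
    -- ... of joint eigenvectors of the operators `χ_a ⋆ ·`
    (∀ a b, dualMul (c.char a) ((fourier G).symm (c.char b)) =
      (c.smat a b / c.smat c.zero b) • (fourier G).symm (c.char b)) ∧
    -- the fusion coefficients exist, are the structure constants of `⋆` on characters,
    -- and are given by the Verlinde formula
    (∃ N, c.IsFusion N) ∧
    (∀ N, c.IsFusion N →
      (∀ a b, dualMul (c.char a) (c.char b) = ∑ d, (N a b d : ℂ) • c.char d) ∧
      ∀ a b d, (N a b d : ℂ) =
        ∑ e, c.smat e a * c.smat e b * star (c.smat d e) / c.smat c.zero e) := by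
  have := fun A => Fintype.ofFinite (Subgroup.centralizer {c.g A})
  exact ⟨c.fourier_char, c.smat_zero_ne_zero,
    c.linearIndependent_char.map' (fourier G).symm.toLinearMap (fourier G).symm.ker,
    c.span_fourier_symm_char, c.dualMul_fourier_symm_char, c.exists_isFusion,
    fun N hN => ⟨c.dualMul_char hN, c.verlinde hN⟩⟩
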